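/- Let $g:\mathbb{N}\to\mathbb{R}$ be strongly additive, i.e. $g(mn)=g(m)+g(n)$ whenever $\gcd(m,n)=1$ and $g(p^k)=g(p)$ for all primes $p$ and integers $k\ge 1$. For $n\ge 2$ let $\rho_n$ be the probability measure on $\mathbb{R}$ given, for Borel sets $A$, by $$\rho_n(A)=\frac{\sum_{p\le n,\ g(p)\in A}1/p}{\sum_{p\le n}1/p},$$ where here and below $p$ runs over primes. Assume that there is a probability measure $\rho$ on $\mathbb{R}$, different from the point mass $\delta_0$, such that for every $\theta\in\mathbb{R}$ we have $\int e^{\theta y}\,\rho(dy)<\infty$ and $\int e^{\theta y}\,\rho_n(dy)\to\int e^{\theta y}\,\rho(dy)$ as $n\to\infty$. Let $$\mu_n=\sum_{p\le n}\frac{g(p)}{p},\qquad \sigma_n^2=\sum_{p\le n}\frac{g(p)^2}{p}\quad(\sigma_n\ge 0),$$ and let $(a_n)$ be a sequence of positive real numbers with $\sigma_n\ll a_n\ll\sigma_n^2$, i.e. $\sigma_n=o(a_n)$ and $a_n=o(\sigma_n^2)$ as $n\to\infty$. Let $V(n)$ be uniformly distributed on $\{1,2,\dots,n\}$ and put $X(n)=g(V(n))$.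 Then the laws of $(X(n)-\mu_n)/a_n$ satisfy the large deviation principle on $\mathbb{R}$ with speed $a_n^2/\sigma_n^2$ and rate function $J(x)=x^2/2$; that is, $J$ is non-negative and lower semicontinuous, and for every Borel set $A\subset\mathbb{R}$, with interior $A^{o}$ and closure $\overline{A}$, $$-\inf_{x\in A^{o}}\frac{x^2}{2}\le\liminf_{n\to\infty}\frac{\sigma_n^2}{a_n^2}\log\mathbb{P}\left(\frac{X(n)-\mu_n}{a_n}\in A\right)\le\limsup_{n\to\infty}\frac{\sigma_n^2}{a_n^2}\log\mathbb{P}\left(\frac{X(n)-\mu_n}{a_n}\in A\right)\le-\inf_{x\in\overline{A}}\frac{x^2}{2},$$ where $\log 0=-\infty$ and the infimum over the empty set is $+\infty$. -/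

import Mathlib

open Filter Topology MeasureTheory ProbabilityTheory Asymptotics
open scoped ENNReal

namespace ErdosKac

/-- The sequence `P` of (probability) measures on `X` satisfies the large deviation principle with
speed `b` and rate function `I`. Logarithms are taken in the extended reals, so that `log 0 = -∞`,
and an infimum over the empty set is `+∞`. -/
structure SatisfiesLDP {X : Type*} [TopologicalSpace X] [MeasurableSpace X]
    (P : ℕ → Measure X) (b : ℕ → ℝ) (I : X → EReal) : Prop where
  nonneg : ∀ x, 0 ≤ I x
  lowerSemicontinuous : LowerSemicontinuous I
  lower : ∀ A : Set X, MeasurableSet A →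
    -(⨅ x ∈ interior A, I x) ≤ liminf (fun n => ENNReal.log (P n A) / (b n : EReal)) atTop
  upper : ∀ A : Set X, MeasurableSet A →
    limsup (fun n => ENNReal.log (P n A) / (b n : EReal)) atTop ≤ -(⨅ x ∈ closure A, I x)

/-- Strongly additive arithmetic functions. -/
structure StronglyAdditive (g : ℕ → ℝ) : Prop where
  prime_pow : ∀ p k : ℕ, p.Prime → 1 ≤ k → g (p ^ k) = g p
  mul : ∀ m n : ℕ, Nat.Coprime m n → g (m * n) = g m + g n

/-- The law of `g p` when the prime `p ≤ n` is chosen with probability proportional to `1 / p`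
(the zero measure if `n < 2`, when there is no such prime). -/
noncomputable def primeLaw (g : ℕ → ℝ) (n : ℕ) : Measure ℝ :=
  (∑ p ∈ Nat.primesLE n, (p : ℝ≥0∞)⁻¹)⁻¹ •
    ∑ p ∈ Nat.primesLE n, (p : ℝ≥0∞)⁻¹ • Measure.dirac (g p)

/-- `g` is strongly additive, `ρ` has finite exponential moments of all orders, and the moment
generating functions of the measures `primeLaw g n` converge pointwise to that of `ρ`. -/
structure HasLimitLaw (g : ℕ → ℝ) (ρ : Measure ℝ) : Prop where
  stronglyAdditive : StronglyAdditive g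
  integrable_exp : ∀ θ : ℝ, Integrable (fun y => Real.exp (θ * y)) ρ
  tendsto_mgf : ∀ θ : ℝ,
    Tendsto (fun n => ∫ y, Real.exp (θ * y) ∂(primeLaw g n)) atTop
      (𝓝 (∫ y, Real.exp (θ * y) ∂ρ))

/-- `μ_n = ∑_{p ≤ n} g(p) / p`. -/
noncomputable def meanSum (g : ℕ → ℝ) (n : ℕ) : ℝ := ∑ p ∈ Nat.primesLE n, g p / p

/-- `σ_n ^ 2 = ∑_{p ≤ n} g(p) ^ 2 / p`. -/
noncomputable def varSum (g : ℕ → ℝ) (n : ℕ) : ℝ := ∑ p ∈ Nat.primesLE n, g p ^ 2 / p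

/-- The law of `(X(n) - μ_n) / a_n`, where `X(n) = g(V(n))` and `V(n)` is uniformly distributed on
`{1, …, n}`. -/
noncomputable def scaledLaw (g : ℕ → ℝ) (a : ℕ → ℝ) (n : ℕ) : Measure ℝ :=
  (uniformOn (Set.Icc 1 n)).map (fun m : ℕ => (g m - meanSum g n) / a n)

theorem isProbabilityMeasure_scaledLaw (g a : ℕ → ℝ) {n : ℕ} (hn : 1 ≤ n) :
    IsProbabilityMeasure (scaledLaw g a n) := by
  have := isProbabilityMeasure_uniformOn (s := Set.Icc 1 n) (Set.finite_Icc 1 n)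
    ⟨1, le_refl 1, hn⟩
  exact Measure.isProbabilityMeasure_map (Measurable.of_discrete).aemeasurable

end ErdosKac

/-!
By the Gärtner–Ellis theorem it suffices to find the limit of the scaled cumulant generating
functions of `X(n)`, hence of the logarithm of the mean over `m ≤ n` of `∏_{p ∣ m} exp (s g(p))`
as `s → 0`. Put `L = ∑_{p ≤ n} 1 / p`.

* If `g` lives on the primes `p ≤ n ^ (1 / L)`, then Rankin's trick shows that this mean value is,
  up to a factor `2`, the one in which the events `p ∣ m` are independent with probability `1 / p`,
  and the latter is computed by Taylor expansion.
* The primes between `n ^ (1 / L)` and `n` satisfy `∑ 1 / p = O(log L)` by Chebyshev's bound. As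
  `∑_{p ≤ n} exp (κ |g(p)|) / p = O(L)` for every `κ`, the Cauchy–Schwarz inequality bounds the
  part of this sum over the large primes by `o(√L)`, so that their scaled cumulant generating
  functions are eventually at most `1`, for every dilation of `s`.
* The cumulant generating function is convex, and writing `u + v` as the combination of
  `(1 - ε)⁻¹ u` and `ε⁻¹ v` with weights `1 - ε` and `ε` shows that the large primes do not
  change the limit.
-/

namespace ErdosKac

/-! ### Sums over primes -/

theorem meanSum_nonneg {f : ℕ → ℝ} (hf : 0 ≤ f) (n : ℕ) : 0 ≤ meanSum f n :=
  Finset.sum_nonneg fun p _ => div_nonneg (hf p) p.cast_nonneg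

theorem meanSum_le_meanSum {f h : ℕ → ℝ} (hfh : f ≤ h) (n : ℕ) : meanSum f n ≤ meanSum h n :=
  Finset.sum_le_sum fun p _ => div_le_div_of_nonneg_right (hfh p) p.cast_nonneg

theorem meanSum_add (f h : ℕ → ℝ) (n : ℕ) : meanSum (f + h) n = meanSum f n + meanSum h n := by
  simp only [meanSum, Pi.add_apply, add_div, Finset.sum_add_distrib]

theorem meanSum_smul (c : ℝ) (f : ℕ → ℝ) (n : ℕ) : meanSum (c • f) n = c * meanSum f n := by
  simp only [meanSum, Pi.smul_apply, smul_eq_mul, mul_div_assoc, Finset.mul_sum]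

theorem meanSum_mul_sq_le (f h : ℕ → ℝ) (n : ℕ) :
    meanSum (f * h) n ^ 2 ≤ meanSum (f ^ 2) n * meanSum (h ^ 2) n :=
  Finset.sum_sq_le_sum_mul_sum_of_sq_le_mul _ (fun p _ => div_nonneg (sq_nonneg _) p.cast_nonneg)
    (fun p _ => div_nonneg (sq_nonneg _) p.cast_nonneg) fun p _ => by
      simp only [Pi.mul_apply, Pi.pow_apply]
      exact le_of_eq (by ring)

theorem varSum_smul (c : ℝ) (f : ℕ → ℝ) (n : ℕ) : varSum (c • f) n = c ^ 2 * varSum f n := by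
  simp only [varSum, Pi.smul_apply, smul_eq_mul, mul_pow, mul_div_assoc, Finset.mul_sum]

theorem tendsto_meanSum_one_atTop : Tendsto (meanSum 1) atTop atTop := by
  have hdiv := (not_summable_iff_tendsto_nat_atTop_of_nonneg fun n =>
    Set.indicator_nonneg (fun _ _ => by positivity) n).1 not_summable_one_div_on_primes
  refine (hdiv.comp (tendsto_add_atTop_nat 1)).congr fun n => ?_
  simp only [Function.comp_apply, meanSum, Nat.primesLE, Nat.primesBelow, Finset.sum_filter,
    Set.indicator_apply, Set.mem_ofPred_eq, Pi.one_apply]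

theorem sum_vonMangoldt_mul_div_le (n : ℕ) :
    ∑ d ∈ Finset.Ioc 0 n, ArithmeticFunction.vonMangoldt d * ((n / d : ℕ) : ℝ)
      ≤ n * Real.log n := by
  rw [← ArithmeticFunction.sum_Ioc_mul_zeta_eq_sum, ArithmeticFunction.vonMangoldt_mul_zeta]
  calc ∑ m ∈ Finset.Ioc 0 n, ArithmeticFunction.log m
      ≤ ∑ _m ∈ Finset.Ioc 0 n, Real.log n := Finset.sum_le_sum fun m hm => by
        rw [Finset.mem_Ioc] at hm
        exact Real.log_le_log (by exact_mod_cast hm.1) (by exact_mod_cast hm.2)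
    _ = n * Real.log n := by simp

theorem meanSum_log_le (n : ℕ) : meanSum (fun p => Real.log p) n ≤ Real.log n + Real.log 4 := by
  rcases n.eq_zero_or_pos with rfl | hn
  · simpa [meanSum] using Real.log_nonneg (by norm_num)
  have hfloor : ∑ p ∈ Nat.primesLE n, Real.log p * ((n / p : ℕ) : ℝ) ≤ n * Real.log n := by
    refine le_trans ?_ (sum_vonMangoldt_mul_div_le n)
    rw [Nat.primesLE_eq_filter_Ioc_zero, Finset.sum_filter]
    refine Finset.sum_le_sum fun p _ => ?_
    split_ifs with hp
    · rw [ArithmeticFunction.vonMangoldt_apply_prime hp]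
    · exact mul_nonneg ArithmeticFunction.vonMangoldt_nonneg (Nat.cast_nonneg _)
  have htheta : ∑ p ∈ Nat.primesLE n, Real.log p ≤ Real.log 4 * n := by
    have := Chebyshev.theta_le_log4_mul_x (x := n) n.cast_nonneg
    rwa [Chebyshev.theta_eq_sum_primesLE_log] at this
  refine le_of_mul_le_mul_right ?_ (Nat.cast_pos (α := ℝ).2 hn)
  calc meanSum (fun p => Real.log p) n * n
      ≤ ∑ p ∈ Nat.primesLE n, (Real.log p * ((n / p : ℕ) : ℝ) + Real.log p) := by
        rw [meanSum, Finset.sum_mul]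
        refine Finset.sum_le_sum fun p _ => ?_
        have hlt : (n : ℝ) / p ≤ ((n / p : ℕ) : ℝ) + 1 := by
          rw [← Nat.floor_div_eq_div (K := ℝ)]
          exact (Nat.lt_floor_add_one _).le
        have := mul_le_mul_of_nonneg_left hlt (Real.log_natCast_nonneg p)
        linarith [div_mul_comm (Real.log p) p n, mul_comm (n / p : ℝ) (Real.log p)]
    _ ≤ (Real.log n + Real.log 4) * n := by
        rw [Finset.sum_add_distrib]
        linarith

/-- The primes `p` (and other natural numbers) such that `p ^ T` exceeds `n`. -/
def largePrimes (T : ℝ) (n : ℕ) : Set ℕ := {p | Real.log n < T * Real.log p}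

theorem mem_largePrimes {T : ℝ} {n p : ℕ} :
    p ∈ largePrimes T n ↔ Real.log n < T * Real.log p :=
  Iff.rfl

theorem meanSum_indicator_largePrimes_two_le (n : ℕ) :
    meanSum ((largePrimes 2 n).indicator 1) n ≤ 6 := by
  rcases lt_or_ge n 2 with hn | hn
  · interval_cases n <;> simp [meanSum]
  have hlog2 : 0 < Real.log 2 := Real.log_pos one_lt_two
  have hlog : Real.log 2 ≤ Real.log n := Real.log_le_log two_pos (by exact_mod_cast hn)
  have hlog4 : Real.log 4 = 2 * Real.log 2 := by
    rw [show (4 : ℝ) = 2 ^ 2 by norm_num, Real.log_pow, Nat.cast_ofNat]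
  have hle : Real.log n • (largePrimes 2 n).indicator 1 ≤ (2 : ℝ) • fun p : ℕ => Real.log p := by
    intro p
    by_cases hp : p ∈ largePrimes 2 n
    · simpa [hp] using le_of_lt hp
    · simpa [hp] using Real.log_natCast_nonneg p
  have := meanSum_le_meanSum hle n
  rw [meanSum_smul, meanSum_smul] at this
  refine le_of_mul_le_mul_left ?_ (hlog2.trans_le hlog)
  linarith [meanSum_log_le n]

theorem log_sqrt_le (n : ℕ) : Real.log n.sqrt ≤ Real.log n / 2 := by
  rcases n.sqrt.eq_zero_or_pos with h | h
  · simpa [h] using div_nonneg (Real.log_natCast_nonneg n) zero_le_two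
  · rw [← Real.log_sqrt n.cast_nonneg]
    exact Real.log_le_log (Nat.cast_pos.2 h) Real.nat_sqrt_le_real_sqrt

theorem meanSum_indicator_largePrimes_pow_le (k n : ℕ) :
    meanSum ((largePrimes (2 ^ k) n).indicator 1) n ≤ 6 * k := by
  induction k generalizing n with
  | zero =>
    refine (Finset.sum_eq_zero fun p hp => ?_).le.trans_eq (by simp)
    rw [Nat.mem_primesLE] at hp
    have : Real.log p ≤ Real.log n :=
      Real.log_le_log (by exact_mod_cast hp.2.pos) (by exact_mod_cast hp.1)
    simp [largePrimes, this]
  | succ k ih =>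
    have hsplit : (Nat.primesLE n).filter (· ≤ n.sqrt) = Nat.primesLE n.sqrt := by
      ext p
      simp only [Finset.mem_filter, Nat.mem_primesLE]
      exact ⟨fun h => ⟨h.2, h.1.2⟩, fun h => ⟨⟨h.1.trans n.sqrt_le_self, h.2⟩, h.1⟩⟩
    have hsmall : ∑ p ∈ (Nat.primesLE n).filter (· ≤ n.sqrt),
        (largePrimes (2 ^ (k + 1)) n).indicator 1 p / (p : ℝ) ≤ 6 * k := by
      rw [hsplit]
      refine le_trans (meanSum_le_meanSum (fun p => ?_) _) (ih n.sqrt)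
      refine Set.indicator_le_indicator_of_subset (fun p hp => ?_) (fun _ => zero_le_one) p
      rw [mem_largePrimes] at hp ⊢
      rw [pow_succ] at hp
      linarith [log_sqrt_le n]
    have hlarge : ∑ p ∈ (Nat.primesLE n).filter (¬ · ≤ n.sqrt),
        (largePrimes (2 ^ (k + 1)) n).indicator 1 p / (p : ℝ) ≤ 6 := by
      refine le_trans ?_ (meanSum_indicator_largePrimes_two_le n)
      refine (Finset.sum_le_sum fun p hp => ?_).trans (Finset.sum_le_sum_of_subset_of_nonneg
        (Finset.filter_subset _ _) fun p _ _ =>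
          div_nonneg (Set.indicator_nonneg (fun _ _ => zero_le_one) p) p.cast_nonneg)
      rw [Finset.mem_filter, Nat.mem_primesLE, not_le, Nat.sqrt_lt'] at hp
      have hlog : Real.log n < Real.log ((p : ℝ) ^ 2) :=
        Real.log_lt_log (Nat.cast_pos.2 (hp.1.2.pos.trans_le hp.1.1)) (by exact_mod_cast hp.2)
      rw [Real.log_pow, Nat.cast_ofNat] at hlog
      rw [Set.indicator_of_mem (mem_largePrimes.2 hlog)]
      gcongr
      exact Set.indicator_le_self' (fun _ _ => zero_le_one) p
    rw [meanSum, ← Finset.sum_filter_add_sum_filter_not _ (· ≤ n.sqrt)]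
    push_cast
    linarith

theorem meanSum_indicator_largePrimes_le {T : ℝ} (hT : 1 ≤ T) (n : ℕ) :
    meanSum ((largePrimes T n).indicator 1) n ≤ 6 * (Real.logb 2 T + 1) := by
  set k := ⌈Real.logb 2 T⌉₊
  have hTk : T ≤ 2 ^ k := by
    rw [← Real.rpow_natCast, ← Real.logb_le_iff_le_rpow one_lt_two (by positivity)]
    exact Nat.le_ceil _
  calc meanSum ((largePrimes T n).indicator 1) n
      ≤ meanSum ((largePrimes (2 ^ k) n).indicator 1) n := by
        refine meanSum_le_meanSum (Set.indicator_le_indicator_of_subset (fun p hp => ?_)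
          fun _ => zero_le_one) n
        exact (mem_largePrimes.1 hp).trans_le
          (mul_le_mul_of_nonneg_right hTk (Real.log_natCast_nonneg p))
    _ ≤ 6 * k := meanSum_indicator_largePrimes_pow_le k n
    _ ≤ 6 * (Real.logb 2 T + 1) := by
        have := Nat.ceil_lt_add_one (Real.logb_nonneg one_lt_two hT)
        gcongr

theorem six_mul_logb_two_add_one_isBigO_log :
    (fun x => 6 * (Real.logb 2 x + 1)) =O[atTop] Real.log :=
  ((Real.isBigO_logb_log.mono le_top).add Real.isLittleO_const_log_atTop.isBigO).const_mul_left 6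

theorem meanSum_one_isLittleO_log : meanSum 1 =o[atTop] fun n : ℕ => Real.log n := by
  have hlog : Tendsto (fun n : ℕ => 2 * Real.log n) atTop atTop :=
    (Real.tendsto_log_atTop.comp tendsto_natCast_atTop_atTop).const_mul_atTop two_pos
  have hbound : ∀ᶠ n in atTop, ‖meanSum 1 n‖ ≤ 6 * (Real.logb 2 (2 * Real.log n) + 1) := by
    filter_upwards [hlog.eventually_ge_atTop 1] with n hn
    rw [Real.norm_of_nonneg (meanSum_nonneg zero_le_one n)]
    refine le_trans (Finset.sum_le_sum fun p hp => ?_) (meanSum_indicator_largePrimes_le hn n)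
    have hp2 : Real.log 2 ≤ Real.log p :=
      Real.log_le_log two_pos (by exact_mod_cast (Nat.mem_primesLE.1 hp).2.two_le)
    have hmem : p ∈ largePrimes (2 * Real.log n) n := by
      rw [mem_largePrimes]
      nlinarith [Real.log_two_gt_d9]
    rw [Set.indicator_of_mem hmem]
  exact (IsBigO.of_norm_eventuallyLE hbound).trans_isLittleO
    ((six_mul_logb_two_add_one_isBigO_log.trans_isLittleO Real.isLittleO_log_id_atTop).comp_tendsto
      hlog) |>.trans_isBigO (isBigO_const_mul_self 2 _ _)

/-! ### Mean values of strongly multiplicative functions -/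

/-- The mean value over `1 ≤ m ≤ n` of the strongly multiplicative function taking the value
`1 + h p` at the prime `p`. -/
noncomputable def meanProd (h : ℕ → ℝ) (n : ℕ) : ℝ :=
  (∑ m ∈ Finset.Ioc 0 n, ∏ p ∈ m.primeFactors, (1 + h p)) / n

theorem powerset_primeFactors {m n : ℕ} (hm : m ∈ Finset.Ioc 0 n) :
    m.primeFactors.powerset = (Nat.primesLE n).powerset.filter (∏ p ∈ ·, p ∣ m) := by
  rw [Finset.mem_Ioc] at hm
  ext D
  simp only [Finset.mem_filter, Finset.mem_powerset]
  refine ⟨fun hD => ⟨fun p hp => ?_, ?_⟩, fun ⟨hD, hdvd⟩ p hp => ?_⟩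
  · have hpm := Nat.mem_primeFactors.1 (hD hp)
    exact Nat.mem_primesLE.2 ⟨(Nat.le_of_dvd hm.1 hpm.2.1).trans hm.2, hpm.1⟩
  · exact (Finset.prod_dvd_prod_of_subset _ _ _ hD).trans m.prod_primeFactors_dvd
  · exact Nat.mem_primeFactors.2
      ⟨Nat.prime_of_mem_primesLE (hD hp), (Finset.dvd_prod_of_mem _ hp).trans hdvd, hm.1.ne'⟩

theorem sum_prod_primeFactors_one_add {R : Type*} [CommSemiring R] (h : ℕ → R) (n : ℕ) :
    ∑ m ∈ Finset.Ioc 0 n, ∏ p ∈ m.primeFactors, (1 + h p)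
      = ∑ D ∈ (Nat.primesLE n).powerset, (∏ p ∈ D, h p) * ((n / ∏ p ∈ D, p : ℕ) : R) := by
  calc ∑ m ∈ Finset.Ioc 0 n, ∏ p ∈ m.primeFactors, (1 + h p)
      = ∑ m ∈ Finset.Ioc 0 n, ∑ D ∈ (Nat.primesLE n).powerset,
          if ∏ p ∈ D, p ∣ m then ∏ p ∈ D, h p else 0 :=
        Finset.sum_congr rfl fun m hm => by
          rw [Finset.prod_one_add, powerset_primeFactors hm, Finset.sum_filter]
    _ = ∑ D ∈ (Nat.primesLE n).powerset, (∏ p ∈ D, h p) * ((n / ∏ p ∈ D, p : ℕ) : R) := by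
        rw [Finset.sum_comm]
        refine Finset.sum_congr rfl fun D _ => ?_
        rw [← Finset.sum_filter, Finset.sum_const, Nat.Ioc_filter_dvd_card_eq_div, nsmul_eq_mul,
          mul_comm]

theorem meanProd_eq_sum_powerset (h : ℕ → ℝ) (n : ℕ) :
    meanProd h n = ∑ D ∈ (Nat.primesLE n).powerset,
      (∏ p ∈ D, h p) * (((n / ∏ p ∈ D, p : ℕ) : ℝ) / n) := by
  simp only [meanProd, sum_prod_primeFactors_one_add, Finset.sum_div, mul_div_assoc]

theorem prod_one_add_div_eq_sum_powerset (h : ℕ → ℝ) (s : Finset ℕ) :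
    ∏ p ∈ s, (1 + h p / p)
      = ∑ D ∈ s.powerset, (∏ p ∈ D, h p) * ((∏ p ∈ D, p : ℕ) : ℝ)⁻¹ := by
  simp only [Finset.prod_one_add, Nat.cast_prod, div_eq_mul_inv, Finset.prod_mul_distrib,
    Finset.prod_inv_distrib]

theorem prod_one_add_div_le_exp {h : ℕ → ℝ} (hh : 0 ≤ h) (n : ℕ) :
    ∏ p ∈ Nat.primesLE n, (1 + h p / p) ≤ Real.exp (meanSum h n) :=
  Real.prod_one_add_le_exp_sum _ fun p => div_nonneg (hh p) p.cast_nonneg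

theorem meanProd_le_exp {h : ℕ → ℝ} (hh : 0 ≤ h) (n : ℕ) :
    meanProd h n ≤ Real.exp (meanSum h n) := by
  refine le_trans ?_ (prod_one_add_div_le_exp hh n)
  rw [meanProd_eq_sum_powerset, prod_one_add_div_eq_sum_powerset]
  refine Finset.sum_le_sum fun D _ =>
    mul_le_mul_of_nonneg_left ?_ (Finset.prod_nonneg fun p _ => hh p)
  refine div_le_of_le_mul₀ n.cast_nonneg (by positivity) (Nat.cast_div_le.trans_eq ?_)
  rw [div_eq_inv_mul]

theorem min_one_le_rpow {x κ : ℝ} (hx : 0 ≤ x) (h0 : 0 ≤ κ) (h1 : κ ≤ 1) : min x 1 ≤ x ^ κ := by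
  rcases le_total x 1 with h | h
  · exact (min_le_left _ _).trans (Real.self_le_rpow_of_le_one hx h h1)
  · exact (min_le_right _ _).trans (Real.one_le_rpow h h0)

theorem abs_cast_div_div_sub_inv_le {n d : ℕ} (hn : n ≠ 0) (hd : d ≠ 0) {κ : ℝ} (h0 : 0 ≤ κ)
    (h1 : κ ≤ 1) : |((n / d : ℕ) : ℝ) / n - (d : ℝ)⁻¹| ≤ (n : ℝ) ^ (-κ) * ((d : ℝ) ^ κ / d) := by
  have hn0 : (0 : ℝ) < n := by exact_mod_cast hn.pos
  have hd0 : (0 : ℝ) < d := by exact_mod_cast hd.pos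
  have hle : ((n / d : ℕ) : ℝ) ≤ n / d := Nat.cast_div_le
  have hlt : (n : ℝ) / d < ((n / d : ℕ) : ℝ) + 1 := by
    rw [← Nat.floor_div_eq_div (K := ℝ)]
    exact Nat.lt_floor_add_one _
  have hdiff : (n / d : ℝ) - ((n / d : ℕ) : ℝ) ≤ min 1 (n / d : ℝ) :=
    le_min (sub_le_iff_le_add'.2 hlt.le) (sub_le_self _ (Nat.cast_nonneg _))
  calc |((n / d : ℕ) : ℝ) / n - (d : ℝ)⁻¹|
      = ((n / d : ℝ) - ((n / d : ℕ) : ℝ)) / n := by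
        rw [abs_sub_comm, abs_of_nonneg]
        · field_simp
        · rw [sub_nonneg, div_le_iff₀ hn0, inv_mul_eq_div]
          exact hle
    _ ≤ min 1 (n / d : ℝ) / n := by gcongr
    _ = min (d / n : ℝ) 1 / d := by
        rw [← min_div_div_right hn0.le, ← min_div_div_right hd0.le]
        congr 1 <;> field_simp
    _ ≤ (d / n : ℝ) ^ κ / d := by
        gcongr
        exact min_one_le_rpow (by positivity) h0 h1
    _ = (n : ℝ) ^ (-κ) * ((d : ℝ) ^ κ / d) := by
        rw [Real.div_rpow hd0.le hn0.le, Real.rpow_neg hn0.le]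
        ring

-- Rankin's trick: the factor `(d / n) ^ κ ≥ min 1 (d / n)` is multiplicative in `d`.
theorem abs_meanProd_sub_prod_le (h : ℕ → ℝ) {n : ℕ} (hn : n ≠ 0) {κ : ℝ} (h0 : 0 ≤ κ)
    (h1 : κ ≤ 1) :
    |meanProd h n - ∏ p ∈ Nat.primesLE n, (1 + h p / p)|
      ≤ (n : ℝ) ^ (-κ) * Real.exp (meanSum (fun p => |h p| * (p : ℝ) ^ κ) n) := by
  refine le_trans ?_ (mul_le_mul_of_nonneg_left
    (prod_one_add_div_le_exp (fun p => by positivity) n) (by positivity))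
  rw [meanProd_eq_sum_powerset, prod_one_add_div_eq_sum_powerset,
    prod_one_add_div_eq_sum_powerset, ← Finset.sum_sub_distrib, Finset.mul_sum]
  refine (Finset.abs_sum_le_sum_abs _ _).trans (Finset.sum_le_sum fun D hD => ?_)
  have hd : ∏ p ∈ D, p ≠ 0 := Finset.prod_ne_zero_iff.2 fun p hp =>
    (Nat.prime_of_mem_primesLE (Finset.mem_powerset.1 hD hp)).ne_zero
  have hrpow : ∏ p ∈ D, (p : ℝ) ^ κ = ((∏ p ∈ D, p : ℕ) : ℝ) ^ κ := by
    rw [Real.finsetProd_rpow _ _ fun p _ => p.cast_nonneg, Nat.cast_prod]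
  rw [← mul_sub, abs_mul, Finset.abs_prod, Finset.prod_mul_distrib, hrpow, mul_assoc,
    mul_left_comm, ← div_eq_mul_inv]
  gcongr
  exact abs_cast_div_div_sub_inv_le hn hd h0 h1

/-! ### Elementary inequalities -/

theorem abs_exp_sub_sum_le (x : ℝ) (n : ℕ) :
    |Real.exp x - ∑ m ∈ Finset.range n, x ^ m / m.factorial| ≤ |x| ^ n * Real.exp |x| := by
  have := Complex.norm_exp_sub_sum_le_norm_mul_exp x n
  rw [Complex.norm_real, Real.norm_eq_abs] at this
  exact_mod_cast this

theorem abs_exp_sub_one_le_mul_exp (x : ℝ) : |Real.exp x - 1| ≤ |x| * Real.exp |x| := by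
  simpa using abs_exp_sub_sum_le x 1

theorem abs_exp_sub_quadratic_le (x : ℝ) :
    |Real.exp x - 1 - x - x ^ 2 / 2| ≤ |x| ^ 3 * Real.exp |x| := by
  simpa [Finset.sum_range_succ, sub_sub, add_assoc] using abs_exp_sub_sum_le x 3

theorem neg_half_le_exp_sub_one_div (x : ℝ) {p : ℕ} (hp : 2 ≤ p) :
    -(1 / 2) ≤ (Real.exp x - 1) / p := by
  have hp2 : (2 : ℝ) ≤ p := by exact_mod_cast hp
  rw [le_div_iff₀ (by linarith)]
  linarith [Real.exp_pos x]

theorem div_one_add_le_log_one_add {u : ℝ} (hu : 0 < 1 + u) : u / (1 + u) ≤ Real.log (1 + u) := by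
  refine le_of_eq_of_le ?_ (Real.one_sub_inv_le_log_of_pos hu)
  field_simp
  ring

theorem abs_log_one_add_sub_le {u : ℝ} (hu : -(1 / 2) ≤ u) :
    |Real.log (1 + u) - u| ≤ 2 * u ^ 2 := by
  have hpos : 0 < 1 + u := by linarith
  have hlower : u - 2 * u ^ 2 ≤ u / (1 + u) := by
    rw [le_div_iff₀ hpos]
    nlinarith [mul_nonneg (sq_nonneg u) (show 0 ≤ 1 + 2 * u by linarith)]
  have hupper := Real.log_le_sub_one_of_pos hpos
  rw [abs_le]
  constructor <;> nlinarith [div_one_add_le_log_one_add hpos]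

theorem neg_two_mul_abs_le_log_one_add {u : ℝ} (hu : -(1 / 2) ≤ u) :
    -(2 * |u|) ≤ Real.log (1 + u) := by
  have hpos : 0 < 1 + u := by linarith
  refine le_trans ?_ (div_one_add_le_log_one_add hpos)
  rw [le_div_iff₀ hpos]
  nlinarith [neg_abs_le u, abs_nonneg u]

theorem abs_log_sub_log_le_log_two {x y : ℝ} (hy : 0 < y) (h : |x - y| ≤ y / 2) :
    |Real.log x - Real.log y| ≤ Real.log 2 := by
  obtain ⟨hlower, hupper⟩ := abs_le.1 h
  have hx : 0 < x := by linarith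
  rw [abs_sub_le_iff, sub_le_iff_le_add, sub_le_iff_le_add, ← Real.log_mul two_ne_zero hy.ne',
    ← Real.log_mul two_ne_zero hx.ne']
  exact ⟨Real.log_le_log hx (by linarith), Real.log_le_log hy (by linarith)⟩

theorem natCast_rpow_le_three {p : ℕ} {κ : ℝ} (h : κ * Real.log p ≤ 1) :
    (p : ℝ) ^ κ ≤ 3 := by
  rcases p.eq_zero_or_pos with rfl | hp
  · exact (Nat.cast_zero (R := ℝ) ▸ Real.zero_rpow_le_one κ).trans (by norm_num)
  · rw [Real.rpow_def_of_pos (Nat.cast_pos.2 hp), mul_comm]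
    exact (Real.exp_le_exp.2 h).trans Real.exp_one_lt_three.le

/-! ### The independent model -/

/-- The moment generating function of `∑_{p ≤ n} w(p) B_p`, where the `B_p` are independent
Bernoulli variables of means `1 / p`. -/
noncomputable def indepMgf (w : ℕ → ℝ) (n : ℕ) : ℝ :=
  ∏ p ∈ Nat.primesLE n, (1 + (Real.exp (w p) - 1) / p)

theorem one_add_exp_sub_one_div_pos (x : ℝ) {n p : ℕ} (hp : p ∈ Nat.primesLE n) :
    0 < 1 + (Real.exp x - 1) / p := by
  linarith [neg_half_le_exp_sub_one_div x (Nat.two_le_of_mem_primesLE hp)]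

theorem indepMgf_pos (w : ℕ → ℝ) (n : ℕ) : 0 < indepMgf w n :=
  Finset.prod_pos fun _ hp => one_add_exp_sub_one_div_pos _ hp

theorem log_indepMgf (w : ℕ → ℝ) (n : ℕ) :
    Real.log (indepMgf w n) = ∑ p ∈ Nat.primesLE n, Real.log (1 + (Real.exp (w p) - 1) / p) :=
  Real.log_prod fun _ hp => (one_add_exp_sub_one_div_pos _ hp).ne'

theorem abs_log_one_add_div_sub_le (x : ℝ) {p : ℕ} (hp : 2 ≤ p) :
    |Real.log (1 + (Real.exp x - 1) / p) - x / p - x ^ 2 / p / 2|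
      ≤ |x| ^ 3 * Real.exp |x| / p + 2 * (x ^ 2 * Real.exp (2 * |x|) / p / p) := by
  have hp0 : (0 : ℝ) < p := by positivity
  have hlog := abs_log_one_add_sub_le (neg_half_le_exp_sub_one_div x hp)
  have hquad : |(Real.exp x - 1) / p - x / p - x ^ 2 / p / 2| ≤ |x| ^ 3 * Real.exp |x| / p := by
    rw [show (Real.exp x - 1) / p - x / p - x ^ 2 / p / 2
      = (Real.exp x - 1 - x - x ^ 2 / 2) / p by ring, abs_div, abs_of_pos hp0]
    gcongr
    exact abs_exp_sub_quadratic_le x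
  have hsq : ((Real.exp x - 1) / p) ^ 2 ≤ x ^ 2 * Real.exp (2 * |x|) / p / p := by
    rw [div_pow, div_div, ← sq, ← sq_abs (Real.exp x - 1), ← sq_abs x, two_mul, Real.exp_add,
      ← sq, ← mul_pow]
    gcongr
    exact abs_exp_sub_one_le_mul_exp x
  have htri := abs_add_le (Real.log (1 + (Real.exp x - 1) / p) - (Real.exp x - 1) / p)
    ((Real.exp x - 1) / p - x / p - x ^ 2 / p / 2)
  rw [← add_sub_assoc, ← add_sub_assoc, sub_add_cancel] at htri
  linarith

theorem abs_log_indepMgf_sub_le (w : ℕ → ℝ) (n : ℕ) :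
    |Real.log (indepMgf w n) - meanSum w n - varSum w n / 2|
      ≤ meanSum (fun p => |w p| ^ 3 * Real.exp |w p|) n
        + 2 * meanSum (fun p => w p ^ 2 * Real.exp (2 * |w p|) / p) n := by
  simp only [log_indepMgf, meanSum, varSum, Finset.sum_div, Finset.mul_sum,
    ← Finset.sum_sub_distrib, ← Finset.sum_add_distrib]
  exact (Finset.abs_sum_le_sum_abs _ _).trans (Finset.sum_le_sum fun p hp =>
    abs_log_one_add_div_sub_le (w p) (Nat.two_le_of_mem_primesLE hp))

theorem neg_two_mul_meanSum_le_log_indepMgf (w : ℕ → ℝ) (n : ℕ) :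
    -(2 * meanSum (fun p => |w p| * Real.exp |w p|) n) ≤ Real.log (indepMgf w n) := by
  rw [log_indepMgf, meanSum, Finset.mul_sum, ← Finset.sum_neg_distrib]
  refine Finset.sum_le_sum fun p hp => le_trans ?_ (neg_two_mul_abs_le_log_one_add
    (neg_half_le_exp_sub_one_div (w p) (Nat.two_le_of_mem_primesLE hp)))
  rw [abs_div, Nat.abs_cast]
  gcongr
  exact abs_exp_sub_one_le_mul_exp (w p)

/-! ### Cumulant generating functions -/

theorem meanProd_exp_sub_one (w : ℕ → ℝ) (n : ℕ) :
    meanProd (fun p => Real.exp (w p) - 1) n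
      = (∑ m ∈ Finset.Ioc 0 n, Real.exp (∑ p ∈ m.primeFactors, w p)) / n := by
  simp only [meanProd, add_sub_cancel, Real.exp_sum]

/-- The logarithm of the mean value over `1 ≤ m ≤ n` of `exp (∑_{p ∣ m} w(p))`, centred by
`∑_{p ≤ n} w(p) / p`: if `w = θ g` with `g` strongly additive, this is the cumulant generating
function of `X(n) - μ_n` at `θ`. -/
noncomputable def centeredCgf (w : ℕ → ℝ) (n : ℕ) : ℝ :=
  Real.log (meanProd (fun p => Real.exp (w p) - 1) n) - meanSum w n

theorem abs_log_meanProd_sub_log_indepMgf_le {w : ℕ → ℝ} {n : ℕ} (hn : n ≠ 0) {κ : ℝ} (h0 : 0 ≤ κ)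
    (h1 : κ ≤ 1) (hw : ∀ p, w p ≠ 0 → κ * Real.log p ≤ 1)
    (hκ : 5 * meanSum (fun p => |w p| * Real.exp |w p|) n + Real.log 2 ≤ κ * Real.log n) :
    |Real.log (meanProd (fun p => Real.exp (w p) - 1) n) - Real.log (indepMgf w n)|
      ≤ Real.log 2 := by
  refine abs_log_sub_log_le_log_two (indepMgf_pos w n)
    ((abs_meanProd_sub_prod_le _ hn h0 h1).trans ?_)
  set S := meanSum (fun p => |w p| * Real.exp |w p|) n with hS
  have hsum : meanSum (fun p => |Real.exp (w p) - 1| * (p : ℝ) ^ κ) n ≤ 3 * S := by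
    rw [hS, ← meanSum_smul]
    refine meanSum_le_meanSum (fun p => ?_) n
    by_cases hp : w p = 0
    · simp [hp]
    · rw [Pi.smul_apply, smul_eq_mul, mul_comm]
      exact mul_le_mul (natCast_rpow_le_three (hw p hp)) (abs_exp_sub_one_le_mul_exp _)
        (abs_nonneg _) (by norm_num)
  calc (n : ℝ) ^ (-κ) * Real.exp (meanSum (fun p => |Real.exp (w p) - 1| * (p : ℝ) ^ κ) n)
      ≤ Real.exp (Real.log n * -κ) * Real.exp (3 * S) := by
        rw [Real.rpow_def_of_pos (Nat.cast_pos.2 hn.pos)]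
        gcongr
    _ ≤ Real.exp (Real.log (indepMgf w n) - Real.log 2) := by
        rw [← Real.exp_add]
        exact Real.exp_le_exp.2 (by linarith [neg_two_mul_meanSum_le_log_indepMgf w n])
    _ = indepMgf w n / 2 := by
        rw [Real.exp_sub, Real.exp_log (indepMgf_pos w n), Real.exp_log two_pos]

theorem abs_centeredCgf_sub_le {w : ℕ → ℝ} {n : ℕ} (hn : n ≠ 0) {κ : ℝ} (h0 : 0 ≤ κ)
    (h1 : κ ≤ 1) (hw : ∀ p, w p ≠ 0 → κ * Real.log p ≤ 1)
    (hκ : 5 * meanSum (fun p => |w p| * Real.exp |w p|) n + Real.log 2 ≤ κ * Real.log n) :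
    |centeredCgf w n - varSum w n / 2|
      ≤ Real.log 2 + (meanSum (fun p => |w p| ^ 3 * Real.exp |w p|) n
        + 2 * meanSum (fun p => w p ^ 2 * Real.exp (2 * |w p|) / p) n) := by
  refine le_trans (le_of_eq_of_le (congrArg _ ?_) (abs_add_le _ _))
    (add_le_add (abs_log_meanProd_sub_log_indepMgf_le hn h0 h1 hw hκ) (abs_log_indepMgf_sub_le w n))
  rw [centeredCgf]
  ring

theorem convexOn_log_sum_exp {ι : Type*} {s : Finset ι} (hs : s.Nonempty) :
    ConvexOn ℝ Set.univ fun x : ι → ℝ => Real.log (∑ i ∈ s, Real.exp (x i)) := by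
  have hpos (x : ι → ℝ) : 0 < ∑ i ∈ s, Real.exp (x i) :=
    Finset.sum_pos (fun i _ => Real.exp_pos (x i)) hs
  have hone (x : ι → ℝ) :
      ∑ i ∈ s, Real.exp (x i - Real.log (∑ j ∈ s, Real.exp (x j))) = 1 := by
    simp_rw [Real.exp_sub, Real.exp_log (hpos x), ← Finset.sum_div, div_self (hpos x).ne']
  refine ⟨convex_univ, fun x _ y _ a b ha hb hab => ?_⟩
  simp only [smul_eq_mul, Pi.add_apply, Pi.smul_apply]
  set A := Real.log (∑ i ∈ s, Real.exp (x i))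
  set B := Real.log (∑ i ∈ s, Real.exp (y i))
  rw [Real.log_le_iff_le_exp (Finset.sum_pos (fun i _ => Real.exp_pos _) hs)]
  calc ∑ i ∈ s, Real.exp (a * x i + b * y i)
      = Real.exp (a * A + b * B) * ∑ i ∈ s, Real.exp (a * (x i - A) + b * (y i - B)) := by
        rw [Finset.mul_sum]
        refine Finset.sum_congr rfl fun i _ => ?_
        rw [← Real.exp_add]
        ring_nf
    _ ≤ Real.exp (a * A + b * B)
          * ∑ i ∈ s, (a * Real.exp (x i - A) + b * Real.exp (y i - B)) := by
        gcongr with i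
        exact convexOn_exp.2 (Set.mem_univ _) (Set.mem_univ _) ha hb hab
    _ = Real.exp (a * A + b * B) := by
        rw [Finset.sum_add_distrib, ← Finset.mul_sum, ← Finset.mul_sum, hone, hone, mul_one,
          mul_one, hab, mul_one]

theorem convexOn_centeredCgf {n : ℕ} (hn : n ≠ 0) :
    ConvexOn ℝ Set.univ fun w => centeredCgf w n := by
  have hne : (Finset.Ioc 0 n).Nonempty := ⟨n, Finset.mem_Ioc.2 ⟨hn.pos, le_rfl⟩⟩
  have heq (w : ℕ → ℝ) : centeredCgf w n
      = Real.log (∑ m ∈ Finset.Ioc 0 n, Real.exp (∑ p ∈ m.primeFactors, w p)) - Real.log n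
        - meanSum w n := by
    rw [centeredCgf, meanProd_exp_sub_one, Real.log_div
      (Finset.sum_pos (fun m _ => Real.exp_pos _) hne).ne' (Nat.cast_ne_zero.2 hn)]
  refine ⟨convex_univ, fun v _ w _ a b ha hb hab => ?_⟩
  have := (convexOn_log_sum_exp hne).2 (Set.mem_univ fun m => ∑ p ∈ m.primeFactors, v p)
    (Set.mem_univ fun m => ∑ p ∈ m.primeFactors, w p) ha hb hab
  simp only [Pi.add_apply, Pi.smul_apply, smul_eq_mul, Finset.mul_sum,
    ← Finset.sum_add_distrib] at this
  simp only [heq, meanSum_add, meanSum_smul, Pi.add_apply, Pi.smul_apply, smul_eq_mul]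
  linear_combination this + Real.log n * hab

theorem tendsto_convexOn_add {ι E : Type*} [AddCommGroup E] [Module ℝ E] {l : Filter ι}
    {F : ι → E → ℝ} {u v : ι → E} {φ : ℝ → ℝ} {C : ℝ} (hF : ∀ᶠ i in l, ConvexOn ℝ Set.univ (F i))
    (hu : ∀ t : ℝ, Tendsto (fun i => F i (t • u i)) l (𝓝 (φ t))) (hφ : ContinuousAt φ 1)
    (hv : ∀ t : ℝ, ∀ᶠ i in l, F i (t • v i) ≤ C) :
    Tendsto (fun i => F i (u i + v i)) l (𝓝 (φ 1)) := by
  have hsub : Tendsto (fun ε : ℝ => 1 - ε) (𝓝[>] 0) (𝓝 1) :=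
    (Continuous.tendsto' (by fun_prop) 0 1 (sub_zero 1)).mono_left nhdsWithin_le_nhds
  have hmul : Tendsto (fun ε : ℝ => ε * C) (𝓝[>] 0) (𝓝 0) :=
    (Continuous.tendsto' (by fun_prop) 0 0 (zero_mul C)).mono_left nhdsWithin_le_nhds
  have hmem : ∀ᶠ ε : ℝ in 𝓝[>] 0, ε ∈ Set.Ioo 0 1 := Ioo_mem_nhdsGT one_pos
  refine tendsto_order.2 ⟨fun a ha => ?_, fun a ha => ?_⟩
  · have hlim : Tendsto (fun ε : ℝ => (1 - ε) * a + ε * C - φ (1 - ε)) (𝓝[>] 0)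
        (𝓝 (1 * a + 0 - φ 1)) :=
      ((hsub.mul_const a).add hmul).sub (hφ.tendsto.comp hsub)
    obtain ⟨ε, hlt, h0, h1⟩ :=
      ((hlim.eventually_lt_const (by linarith : 1 * a + 0 - φ 1 < 0)).and hmem).exists
    filter_upwards [hF, (hu (1 - ε)).eventually_const_lt (sub_neg.1 hlt),
      hv (-((1 - ε) / ε))] with i hconv hui hvi
    have := hconv.2 (Set.mem_univ (u i + v i)) (Set.mem_univ (-((1 - ε) / ε) • v i))
      (sub_nonneg.2 h1.le) h0.le (sub_add_cancel 1 ε)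
    rw [smul_smul, mul_neg, mul_div_cancel₀ _ h0.ne', smul_add, neg_smul, add_neg_cancel_right,
      smul_eq_mul, smul_eq_mul] at this
    have := mul_le_mul_of_nonneg_left hvi h0.le
    exact lt_of_mul_lt_mul_left (by linarith) (sub_nonneg.2 h1.le)
  · have hlim : Tendsto (fun ε : ℝ => (1 - ε) * φ (1 - ε)⁻¹ + ε * C) (𝓝[>] 0)
        (𝓝 (1 * φ 1 + 0)) :=
      (hsub.mul (hφ.tendsto.comp (by simpa using hsub.inv₀ one_ne_zero))).add hmul
    obtain ⟨ε, hlt, h0, h1⟩ :=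
      ((hlim.eventually_lt_const (by linarith : 1 * φ 1 + 0 < a)).and hmem).exists
    filter_upwards [hF, ((hu (1 - ε)⁻¹).const_mul (1 - ε)).eventually_lt_const
      (lt_sub_iff_add_lt.2 hlt), hv ε⁻¹] with i hconv hui hvi
    have := hconv.2 (Set.mem_univ ((1 - ε)⁻¹ • u i)) (Set.mem_univ (ε⁻¹ • v i))
      (sub_nonneg.2 h1.le) h0.le (sub_add_cancel 1 ε)
    rw [smul_inv_smul₀ (sub_pos.2 h1).ne', smul_inv_smul₀ h0.ne', smul_eq_mul, smul_eq_mul] at this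
    linarith [mul_le_mul_of_nonneg_left hvi h0.le]

/-! ### Large primes -/

theorem meanProd_exp_sub_one_pos (w : ℕ → ℝ) {n : ℕ} (hn : n ≠ 0) :
    0 < meanProd (fun p => Real.exp (w p) - 1) n := by
  rw [meanProd_exp_sub_one]
  exact div_pos (Finset.sum_pos (fun m _ => Real.exp_pos _) ⟨n, Finset.mem_Ioc.2 ⟨hn.pos, le_rfl⟩⟩)
    (Nat.cast_pos.2 hn.pos)

theorem centeredCgf_le (w : ℕ → ℝ) {n : ℕ} (hn : n ≠ 0) :
    centeredCgf w n ≤ 2 * meanSum (fun p => |w p| * Real.exp |w p|) n := by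
  have hexp (p : ℕ) : 0 ≤ Real.exp |w p| - 1 := sub_nonneg.2 (Real.one_le_exp (abs_nonneg _))
  have hlog : Real.log (meanProd (fun p => Real.exp (w p) - 1) n)
      ≤ meanSum (fun p => Real.exp |w p| - 1) n := by
    rw [Real.log_le_iff_le_exp (meanProd_exp_sub_one_pos w hn)]
    refine le_trans ?_ (meanProd_le_exp hexp n)
    rw [meanProd_exp_sub_one, meanProd_exp_sub_one fun p => |w p|]
    gcongr with m _ p
    exact le_abs_self (w p)
  have hmean : meanSum (fun p => Real.exp |w p| - 1) n
      ≤ meanSum (fun p => |w p| * Real.exp |w p|) n :=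
    meanSum_le_meanSum (fun p => by
      simpa using (le_abs_self _).trans (abs_exp_sub_one_le_mul_exp |w p|)) n
  have hneg : -meanSum w n ≤ meanSum (fun p => |w p| * Real.exp |w p|) n := by
    rw [neg_eq_neg_one_mul, ← meanSum_smul]
    refine meanSum_le_meanSum (fun p => ?_) n
    rw [Pi.smul_apply, smul_eq_mul, neg_one_mul]
    exact (neg_le_abs _).trans
      (le_mul_of_one_le_right (abs_nonneg _) (Real.one_le_exp (abs_nonneg _)))
  rw [centeredCgf]
  linarith

theorem meanSum_indicator_one_nonneg (A : Set ℕ) (n : ℕ) : 0 ≤ meanSum (A.indicator 1) n :=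
  meanSum_nonneg (Set.indicator_nonneg fun _ _ => zero_le_one) n

theorem meanSum_indicator_sq_le (A : Set ℕ) (f : ℕ → ℝ) (n : ℕ) :
    meanSum (A.indicator f) n ^ 2
      ≤ meanSum (A.indicator 1) n * meanSum (A.indicator (f ^ 2)) n := by
  convert meanSum_mul_sq_le (A.indicator 1) (A.indicator f) n using 3 <;>
  · ext p
    by_cases hp : p ∈ A <;> simp [hp]

theorem meanSum_indicator_pow_four_le (A : Set ℕ) (f : ℕ → ℝ) (n : ℕ) :
    meanSum (A.indicator f) n ^ 4 ≤ meanSum (A.indicator 1) n ^ 3 * meanSum (f ^ 4) n := by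
  have hone := meanSum_indicator_one_nonneg A n
  have hfour : meanSum (A.indicator ((f ^ 2) ^ 2)) n ≤ meanSum (f ^ 4) n := by
    rw [← pow_mul]
    exact meanSum_le_meanSum (Set.indicator_le_self' fun p _ => by
      simpa using Even.pow_nonneg (by decide : Even 4) (f p)) n
  calc meanSum (A.indicator f) n ^ 4
      = (meanSum (A.indicator f) n ^ 2) ^ 2 := by ring
    _ ≤ (meanSum (A.indicator 1) n * meanSum (A.indicator (f ^ 2)) n) ^ 2 := by
        gcongr
        exact meanSum_indicator_sq_le A f n
    _ ≤ meanSum (A.indicator 1) n ^ 2 * (meanSum (A.indicator 1) n * meanSum (f ^ 4) n) := by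
        rw [mul_pow]
        gcongr
        exact (meanSum_indicator_sq_le A _ n).trans (by gcongr)
    _ = meanSum (A.indicator 1) n ^ 3 * meanSum (f ^ 4) n := by ring

theorem meanSum_inv_sq_le_one (n : ℕ) : meanSum (fun p => ((p : ℝ) ^ 2)⁻¹) n ≤ 1 := by
  calc meanSum (fun p => ((p : ℝ) ^ 2)⁻¹) n
      ≤ ∑ p ∈ Nat.primesLE n, ((p : ℝ) ^ 2)⁻¹ :=
        Finset.sum_le_sum fun p hp => div_le_self (by positivity)
          (by exact_mod_cast (Nat.prime_of_mem_primesLE hp).one_le)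
    _ ≤ ∑ p ∈ Finset.Ioc 1 (max 1 n), ((p : ℝ) ^ 2)⁻¹ := by
        refine Finset.sum_le_sum_of_subset_of_nonneg (fun p hp => ?_) fun _ _ _ => by positivity
        rw [Nat.mem_primesLE] at hp
        exact Finset.mem_Ioc.2 ⟨hp.2.one_lt, le_max_of_le_right hp.1⟩
    _ ≤ ((1 : ℕ) : ℝ)⁻¹ - ((max 1 n : ℕ) : ℝ)⁻¹ :=
        sum_Ioc_inv_sq_le_sub one_ne_zero (le_max_left 1 n)
    _ ≤ 1 := by
        rw [Nat.cast_one, inv_one]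
        exact sub_le_self _ (by positivity)

theorem meanSum_div_sq_le (f : ℕ → ℝ) (n : ℕ) :
    meanSum (fun p => f p / p) n ^ 2 ≤ meanSum (f ^ 2) n := by
  have := meanSum_mul_sq_le f (fun p => (p : ℝ)⁻¹) n
  refine this.trans (mul_le_of_le_one_right (meanSum_nonneg (fun p => sq_nonneg _) n) ?_)
  refine le_of_eq_of_le ?_ (meanSum_inv_sq_le_one n)
  congr 1
  ext p
  simp

theorem meanSum_indicator_largePrimes_isBigO :
    (fun n => meanSum ((largePrimes (meanSum 1 n) n).indicator 1) n)
      =O[atTop] fun n => Real.log (meanSum 1 n) := by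
  refine IsBigO.trans (.of_norm_eventuallyLE ?_)
    (six_mul_logb_two_add_one_isBigO_log.comp_tendsto tendsto_meanSum_one_atTop)
  filter_upwards [tendsto_meanSum_one_atTop.eventually_ge_atTop 1] with n hn
  rw [Real.norm_of_nonneg (meanSum_indicator_one_nonneg _ n)]
  exact meanSum_indicator_largePrimes_le hn n

theorem meanSum_indicator_largePrimes_isLittleO {f : ℕ → ℝ}
    (hf : meanSum (f ^ 4) =O[atTop] meanSum 1) :
    (fun n => meanSum ((largePrimes (meanSum 1 n) n).indicator f) n)
      =o[atTop] fun n => √(meanSum 1 n) := by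
  have hlog : (fun n => Real.log (meanSum 1 n) ^ 3) =o[atTop] meanSum 1 :=
    Real.isLittleO_pow_log_id_atTop.comp_tendsto tendsto_meanSum_one_atTop
  have hcube := (meanSum_indicator_largePrimes_isBigO.pow 3).trans_isLittleO hlog
  refine .of_pow (n := 4) (IsBigO.trans_isLittleO (.of_norm_le fun n => ?_)
    ((hcube.mul_isBigO hf).congr_right fun n => ?_)) four_ne_zero
  · rw [Pi.pow_apply, Real.norm_of_nonneg (Even.pow_nonneg (by decide : Even 4) _)]
    exact meanSum_indicator_pow_four_le _ f n
  · rw [Pi.pow_apply, show 4 = 2 * 2 by rfl, pow_mul,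
      Real.sq_sqrt (meanSum_nonneg zero_le_one n), sq]

/-! ### Limits of cumulant generating functions -/

/-- The function `exp (κ |g|)`, whose averages over the primes are the exponential moments of
`g`. -/
noncomputable def expAbs (κ : ℝ) (g : ℕ → ℝ) : ℕ → ℝ := fun p => Real.exp (κ * |g p|)

theorem expAbs_nonneg (κ : ℝ) (g : ℕ → ℝ) : 0 ≤ expAbs κ g := fun _ => Real.exp_nonneg _

theorem expAbs_pow (κ : ℝ) (g : ℕ → ℝ) (k : ℕ) : expAbs κ g ^ k = expAbs (k * κ) g := by
  ext p
  rw [Pi.pow_apply, expAbs, expAbs, ← Real.exp_nat_mul, mul_assoc]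

theorem expAbs_mono {κ κ' : ℝ} (h : κ ≤ κ') (g : ℕ → ℝ) : expAbs κ g ≤ expAbs κ' g := fun p =>
  Real.exp_le_exp.2 (mul_le_mul_of_nonneg_right h (abs_nonneg (g p)))

theorem meanSum_expAbs_isBigO_of_le {κ κ' : ℝ} (h : κ ≤ κ') {g f : ℕ → ℝ}
    (hexp : meanSum (expAbs κ' g) =O[atTop] f) : meanSum (expAbs κ g) =O[atTop] f := by
  refine IsBigO.trans (.of_norm_le fun n => ?_) hexp
  rw [Real.norm_of_nonneg (meanSum_nonneg (expAbs_nonneg κ g) n)]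
  exact meanSum_le_meanSum (expAbs_mono h g) n

theorem abs_pow_mul_exp_le {s : ℝ} (hs : |s| ≤ 1) (x : ℝ) {k : ℕ} {j : ℝ} (hj : 0 ≤ j) :
    |s * x| ^ k * Real.exp (j * |s * x|) ≤ |s| ^ k * Real.exp ((k + j) * |x|) := by
  have hpow : |x| ^ k ≤ Real.exp (k * |x|) := by
    rw [Real.exp_nat_mul]
    gcongr
    linarith [Real.add_one_le_exp |x|]
  have hexp : Real.exp (j * |s * x|) ≤ Real.exp (j * |x|) := by
    rw [abs_mul]
    gcongr
    exact mul_le_of_le_one_left (abs_nonneg x) hs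
  rw [abs_mul, mul_pow, mul_assoc, add_mul, Real.exp_add, ← abs_mul]
  gcongr

theorem abs_indicator_pow_mul_exp_le (A : Set ℕ) (g : ℕ → ℝ) {s : ℝ} (hs : |s| ≤ 1) {k : ℕ}
    (hk : k ≠ 0) {j κ : ℝ} (hj : 0 ≤ j) (hκ : k + j ≤ κ) :
    (fun p => |A.indicator (s • g) p| ^ k * Real.exp (j * |A.indicator (s • g) p|))
      ≤ |s| ^ k • A.indicator (expAbs κ g) := by
  intro p
  by_cases hp : p ∈ A
  · simp only [Pi.smul_apply, Set.indicator_of_mem hp, smul_eq_mul]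
    exact (abs_pow_mul_exp_le hs (g p) hj).trans (by gcongr; exact expAbs_mono hκ g p)
  · simp [Set.indicator_of_notMem hp, hk]

theorem meanSum_indicator_pow_mul_exp_le (A : Set ℕ) (g : ℕ → ℝ) {s : ℝ} (hs : |s| ≤ 1) {k : ℕ}
    (hk : k ≠ 0) {j κ : ℝ} (hj : 0 ≤ j) (hκ : k + j ≤ κ) (n : ℕ) :
    meanSum (fun p => |A.indicator (s • g) p| ^ k * Real.exp (j * |A.indicator (s • g) p|)) n
      ≤ |s| ^ k * meanSum (A.indicator (expAbs κ g)) n :=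
  (meanSum_le_meanSum (abs_indicator_pow_mul_exp_le A g hs hk hj hκ) n).trans_eq
    (meanSum_smul _ _ n)

theorem isLittleO_sqrt_id_atTop : Real.sqrt =o[atTop] (id : ℝ → ℝ) := by
  have : (fun x : ℝ => x ^ 1) =o[atTop] fun x => x ^ 2 := isLittleO_pow_pow_atTop_of_lt one_lt_two
  refine .of_pow (n := 2) (this.congr' ?_ .rfl) two_ne_zero
  filter_upwards [eventually_ge_atTop 0] with x hx
  rw [pow_one, Pi.pow_apply, Real.sq_sqrt hx]

theorem sqrt_meanSum_one_isLittleO : (fun n => √(meanSum 1 n)) =o[atTop] meanSum 1 :=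
  isLittleO_sqrt_id_atTop.comp_tendsto tendsto_meanSum_one_atTop

section

variable {g s b : ℕ → ℝ}

theorem eventually_centeredCgf_large_le (hexp : meanSum (expAbs 16 g) =O[atTop] meanSum 1)
    (hs : Tendsto s atTop (𝓝 0)) (hb : Tendsto b atTop atTop)
    (hsb : (fun n => s n ^ 2 * meanSum 1 n) =O[atTop] b) :
    ∀ᶠ n in atTop,
      centeredCgf ((largePrimes (meanSum 1 n) n).indicator (s n • g)) n / b n ≤ 1 := by
  have hM : (fun n => meanSum ((largePrimes (meanSum 1 n) n).indicator (expAbs 4 g)) n)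
      =o[atTop] fun n => √(meanSum 1 n) :=
    meanSum_indicator_largePrimes_isLittleO (by rw [expAbs_pow]; norm_num; exact hexp)
  have hsqrt : (fun n => |s n| * √(meanSum 1 n)) =O[atTop] b := by
    have hone : (fun _ => (1 : ℝ)) =O[atTop] b :=
      (isLittleO_const_left.2 (.inr (tendsto_abs_atTop_atTop.comp hb))).isBigO
    refine IsBigO.trans (.of_norm_le fun n => ?_) (hone.add hsb)
    rw [Real.norm_of_nonneg (by positivity), ← sq_abs (s n)]
    nlinarith [sq_nonneg (|s n| * √(meanSum 1 n) - 1),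
      Real.sq_sqrt (meanSum_nonneg zero_le_one n)]
  have hsM := (((isBigO_refl (fun n => |s n|) atTop).mul_isLittleO hM).trans_isBigO
    hsqrt).const_mul_left 2
  filter_upwards [hsM.bound one_pos, hb.eventually_gt_atTop 0, eventually_ne_atTop 0,
    (tendsto_zero_iff_abs_tendsto_zero s).1 hs |>.eventually_le_const one_pos]
    with n hn hbn hn0 hsn
  rw [one_mul, Real.norm_of_nonneg hbn.le] at hn
  have hexp := meanSum_indicator_pow_mul_exp_le (largePrimes (meanSum 1 n) n) g hsn one_ne_zero
    zero_le_one (κ := 4) (by norm_num) n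
  simp only [pow_one, one_mul] at hexp
  rw [div_le_one hbn]
  linarith [centeredCgf_le ((largePrimes (meanSum 1 n) n).indicator (s n • g)) hn0,
    Real.le_norm_self (2 * (|s n|
      * meanSum ((largePrimes (meanSum 1 n) n).indicator (expAbs 4 g)) n))]

theorem varSum_indicator_add_compl (A : Set ℕ) (f : ℕ → ℝ) (n : ℕ) :
    varSum (A.indicator f) n + varSum (Aᶜ.indicator f) n = varSum f n := by
  rw [varSum, varSum, varSum, ← Finset.sum_add_distrib]
  refine Finset.sum_congr rfl fun p _ => ?_
  by_cases hp : p ∈ A <;> simp [hp]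

theorem varSum_nonneg (g : ℕ → ℝ) (n : ℕ) : 0 ≤ varSum g n :=
  Finset.sum_nonneg fun _ _ => by positivity

theorem varSum_indicator_le (A : Set ℕ) (g : ℕ → ℝ) {s : ℝ} (hs : |s| ≤ 1) (n : ℕ) :
    varSum (A.indicator (s • g)) n ≤ s ^ 2 * meanSum (A.indicator (expAbs 4 g)) n := by
  have := meanSum_indicator_pow_mul_exp_le A g hs two_ne_zero le_rfl
    (by norm_num : ((2 : ℕ) : ℝ) + 0 ≤ 4) n
  simpa only [sq_abs, zero_mul, Real.exp_zero, mul_one, varSum] using! this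

theorem meanSum_indicator_pow_mul_exp_le_meanSum (A : Set ℕ) (g : ℕ → ℝ) {s : ℝ} (hs : |s| ≤ 1)
    {k : ℕ} (hk : k ≠ 0) {j κ : ℝ} (hj : 0 ≤ j) (hκ : k + j ≤ κ) (n : ℕ) :
    meanSum (fun p => |A.indicator (s • g) p| ^ k * Real.exp (j * |A.indicator (s • g) p|)) n
      ≤ |s| ^ k * meanSum (expAbs κ g) n :=
  (meanSum_indicator_pow_mul_exp_le A g hs hk hj hκ n).trans (mul_le_mul_of_nonneg_left
    (meanSum_le_meanSum (Set.indicator_le_self' fun p _ => expAbs_nonneg κ g p) n) (by positivity))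

theorem meanSum_indicator_sq_mul_exp_div_le (A : Set ℕ) (g : ℕ → ℝ) {s : ℝ} (hs : |s| ≤ 1) (n : ℕ) :
    meanSum (fun p => A.indicator (s • g) p ^ 2 * Real.exp (2 * |A.indicator (s • g) p|) / p) n
      ≤ s ^ 2 * meanSum (fun p => expAbs 4 g p / p) n := by
  rw [← meanSum_smul]
  refine meanSum_le_meanSum (fun p => ?_) n
  have := (abs_indicator_pow_mul_exp_le A g hs two_ne_zero zero_le_two (κ := 4) (by norm_num)).trans
    (smul_le_smul_of_nonneg_left (Set.indicator_le_self' fun p _ => expAbs_nonneg 4 g p)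
      (by positivity)) p
  simp only [sq_abs, Pi.smul_apply, smul_eq_mul] at this
  simpa only [Pi.smul_apply, smul_eq_mul, mul_div_assoc] using
    div_le_div_of_nonneg_right this (Nat.cast_nonneg p)

theorem abs_centeredCgf_small_sub_le (g : ℕ → ℝ) {s : ℝ} (hs : |s| ≤ 1) {n : ℕ} (hn : n ≠ 0)
    (hlog : meanSum 1 n ≤ Real.log n) (hpos : 0 < meanSum 1 n)
    (hL : 5 * (|s| * meanSum (expAbs 4 g) n) + Real.log 2 ≤ meanSum 1 n) :
    |centeredCgf ((largePrimes (meanSum 1 n) n)ᶜ.indicator (s • g)) n - varSum (s • g) n / 2|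
      ≤ Real.log 2 + s ^ 2 * (|s| * meanSum (expAbs 4 g) n
        + 2 * meanSum (fun p => expAbs 4 g p / p) n
        + meanSum ((largePrimes (meanSum 1 n) n).indicator (expAbs 4 g)) n) := by
  set A := largePrimes (meanSum 1 n) n
  have hlogpos : 0 < Real.log n := hpos.trans_le hlog
  have hw (p : ℕ) (hp : Aᶜ.indicator (s • g) p ≠ 0) :
      meanSum 1 n / Real.log n * Real.log p ≤ 1 := by
    have : p ∉ A := fun h => hp (Set.indicator_of_notMem (Set.notMem_compl_iff.2 h) _)
    rw [mem_largePrimes, not_lt] at this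
    rwa [div_mul_eq_mul_div, div_le_one hlogpos]
  have hfirst := meanSum_indicator_pow_mul_exp_le_meanSum Aᶜ g hs one_ne_zero zero_le_one (κ := 4)
    (by norm_num) n
  have hthird := meanSum_indicator_pow_mul_exp_le_meanSum Aᶜ g hs three_ne_zero zero_le_one (κ := 4)
    (by norm_num) n
  simp only [pow_one, one_mul] at hfirst hthird
  have hsmall := abs_centeredCgf_sub_le hn (by positivity) ((div_le_one hlogpos).2 hlog) hw
    (by rw [div_mul_cancel₀ _ hlogpos.ne']; linarith)
  have hvar := varSum_indicator_add_compl A (s • g) n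
  have hlarge := varSum_indicator_le A g hs n
  have hdiv := meanSum_indicator_sq_mul_exp_div_le Aᶜ g hs n
  have hnonneg := varSum_nonneg (A.indicator (s • g)) n
  rw [pow_succ, sq_abs] at hthird
  rw [abs_le] at hsmall ⊢
  constructor <;> linarith

theorem meanSum_div_isLittleO {f : ℕ → ℝ} (hf : meanSum (f ^ 2) =O[atTop] meanSum 1) :
    meanSum (fun p => f p / p) =o[atTop] meanSum 1 := by
  refine IsBigO.trans_isLittleO (.of_pow two_ne_zero (IsBigO.trans (.of_norm_le fun n => ?_)
    (hf.trans ?_))) sqrt_meanSum_one_isLittleO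
  · rw [Pi.pow_apply, Real.norm_of_nonneg (sq_nonneg _)]
    exact meanSum_div_sq_le f n
  · exact .of_norm_le fun n => by
      rw [Pi.pow_apply, Real.sq_sqrt (meanSum_nonneg zero_le_one n),
        Real.norm_of_nonneg (meanSum_nonneg zero_le_one n)]

theorem tendsto_centeredCgf_small (hexp : meanSum (expAbs 16 g) =O[atTop] meanSum 1)
    (hs : Tendsto s atTop (𝓝 0)) (hb : Tendsto b atTop atTop)
    (hsb : (fun n => s n ^ 2 * meanSum 1 n) =O[atTop] b) {c : ℝ}
    (hvar : Tendsto (fun n => varSum (s n • g) n / b n) atTop (𝓝 c)) :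
    Tendsto (fun n => centeredCgf ((largePrimes (meanSum 1 n) n)ᶜ.indicator (s n • g)) n / b n)
      atTop (𝓝 (c / 2)) := by
  have hs0 : Tendsto (fun n => |s n|) atTop (𝓝 0) := (tendsto_zero_iff_abs_tendsto_zero s).1 hs
  have hR : (fun n => |s n| * meanSum (expAbs 4 g) n) =o[atTop] meanSum 1 := by
    simpa using ((isLittleO_one_iff ℝ).2 hs0).mul_isBigO
      (meanSum_expAbs_isBigO_of_le (by norm_num) hexp)
  have hdiv : meanSum (fun p => expAbs 4 g p / p) =o[atTop] meanSum 1 :=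
    meanSum_div_isLittleO (by
      rw [expAbs_pow]
      exact meanSum_expAbs_isBigO_of_le (by norm_num) hexp)
  have hM : (fun n => meanSum ((largePrimes (meanSum 1 n) n).indicator (expAbs 4 g)) n)
      =o[atTop] meanSum 1 :=
    (meanSum_indicator_largePrimes_isLittleO (by rw [expAbs_pow]; norm_num; exact hexp)).trans
      sqrt_meanSum_one_isLittleO
  have hlog2 (f : ℕ → ℝ) (hf : Tendsto f atTop atTop) : (fun _ => Real.log 2) =o[atTop] f :=
    isLittleO_const_left.2 (.inr (tendsto_abs_atTop_atTop.comp hf))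
  have herr := (hlog2 b hb).add
    (((isBigO_refl (fun n => s n ^ 2) atTop).mul_isLittleO
      ((hR.add (hdiv.const_mul_left 2)).add hM)).trans_isBigO hsb)
  have hsub : (fun n => centeredCgf ((largePrimes (meanSum 1 n) n)ᶜ.indicator (s n • g)) n
      - varSum (s n • g) n / 2) =o[atTop] b := by
    refine IsBigO.trans_isLittleO (.of_bound' ?_) herr
    filter_upwards [hs0.eventually_le_const one_pos, eventually_ne_atTop 0,
      meanSum_one_isLittleO_log.bound one_pos, tendsto_meanSum_one_atTop.eventually_gt_atTop 0,
      ((hR.const_mul_left 5).add (hlog2 _ tendsto_meanSum_one_atTop)).bound one_pos]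
    with n hsn hn hlog hpos hL
    rw [one_mul, Real.norm_of_nonneg hpos.le] at hL
    rw [one_mul, Real.norm_of_nonneg hpos.le, Real.norm_of_nonneg (Real.log_natCast_nonneg n)]
      at hlog
    exact (abs_centeredCgf_small_sub_le g hsn hn hlog hpos ((Real.le_norm_self _).trans hL)).trans
      (Real.le_norm_self _)
  have := hsub.tendsto_div_nhds_zero.add (hvar.div_const 2)
  rw [zero_add] at this
  exact this.congr fun n => by ring

theorem tendsto_centeredCgf_of_expAbs_sixteen (hexp : meanSum (expAbs 16 g) =O[atTop] meanSum 1)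
    (hvar : meanSum 1 =O[atTop] varSum g) (hs : Tendsto s atTop (𝓝 0))
    (hb : Tendsto b atTop atTop) {c : ℝ}
    (hc : Tendsto (fun n => varSum (s n • g) n / b n) atTop (𝓝 c)) :
    Tendsto (fun n => centeredCgf (s n • g) n / b n) atTop (𝓝 (c / 2)) := by
  have hb0 : ∀ᶠ n in atTop, b n ≠ 0 := hb.eventually_ne_atTop 0
  have hsb : (fun n => s n ^ 2 * meanSum 1 n) =O[atTop] b := by
    refine ((isBigO_refl (fun n => s n ^ 2) atTop).mul hvar).trans
      (isBigO_of_div_tendsto_nhds (hb0.mono fun n hn h => absurd h hn) c ?_)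
    simpa only [varSum_smul] using! hc
  have hst (t : ℝ) : Tendsto (fun n => t * s n) atTop (𝓝 0) := by simpa using hs.const_mul t
  have hsbt (t : ℝ) : (fun n => (t * s n) ^ 2 * meanSum 1 n) =O[atTop] b := by
    simpa only [mul_pow, mul_assoc] using hsb.const_mul_left (t ^ 2)
  have hsmul (A : Set ℕ) (t : ℝ) (n : ℕ) :
      t • A.indicator (s n • g) = A.indicator ((t * s n) • g) := by
    rw [mul_smul]
    exact (Set.indicator_const_smul A t (s n • g)).symm
  have := tendsto_convexOn_add (F := fun n w => centeredCgf w n / b n)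
    (u := fun n => (largePrimes (meanSum 1 n) n)ᶜ.indicator (s n • g))
    (v := fun n => (largePrimes (meanSum 1 n) n).indicator (s n • g))
    (φ := fun t => t ^ 2 * c / 2) (C := 1) (l := atTop) ?_ (fun t => ?_) (by fun_prop) fun t => ?_
  · simpa only [Set.indicator_compl_add_self, one_pow, one_mul] using this
  · filter_upwards [hb.eventually_gt_atTop 0, eventually_ne_atTop 0] with n hbn hn
    simpa only [div_eq_inv_mul, smul_eq_mul] using!
      (convexOn_centeredCgf hn).smul (inv_nonneg.2 hbn.le)
  · simp only [hsmul]
    refine tendsto_centeredCgf_small hexp (hst t) hb (hsbt t) ?_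
    simpa only [mul_smul, varSum_smul, mul_div_assoc] using hc.const_mul (t ^ 2)
  · simpa only [hsmul] using eventually_centeredCgf_large_le hexp (hst t) hb (hsbt t)

theorem tendsto_centeredCgf {κ : ℝ} (hκ : 0 < κ) (hexp : meanSum (expAbs κ g) =O[atTop] meanSum 1)
    (hvar : meanSum 1 =O[atTop] varSum g) (hs : Tendsto s atTop (𝓝 0))
    (hb : Tendsto b atTop atTop) {c : ℝ}
    (hc : Tendsto (fun n => varSum (s n • g) n / b n) atTop (𝓝 c)) :
    Tendsto (fun n => centeredCgf (s n • g) n / b n) atTop (𝓝 (c / 2)) := by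
  have hsmul (n : ℕ) : (s n * (16 / κ)) • (κ / 16) • g = s n • g := by
    rw [smul_smul]
    congr 1
    field_simp
  have hexp16 : expAbs 16 ((κ / 16) • g) = expAbs κ g := by
    ext p
    rw [expAbs, expAbs, Pi.smul_apply, smul_eq_mul, abs_mul, abs_of_pos (by positivity)]
    congr 1
    ring
  have hvar' : meanSum 1 =O[atTop] varSum ((κ / 16) • g) := by
    refine hvar.trans (.of_bound ((16 / κ) ^ 2) (.of_forall fun n => le_of_eq ?_))
    rw [varSum_smul, norm_mul, ← mul_assoc, Real.norm_of_nonneg (by positivity : 0 ≤ (κ / 16) ^ 2),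
      ← mul_pow, div_mul_div_cancel₀ hκ.ne', div_self (by norm_num), one_pow, one_mul]
  have := tendsto_centeredCgf_of_expAbs_sixteen (g := (κ / 16) • g)
    (s := fun n => s n * (16 / κ)) (b := b) (c := c) (by rwa [hexp16]) hvar'
    (by simpa using hs.mul_const (16 / κ)) hb (by simpa only [hsmul] using hc)
  simpa only [hsmul] using this

end

/-! ### The Gärtner–Ellis theorem with Gaussian limit -/

theorem ennrealLog_div_le_of_toReal_le {p : ℝ≥0∞} (hp : p ≠ ∞) {b c : ℝ} (hb : 0 < b)
    (h : p.toReal ≤ Real.exp (b * c)) : ENNReal.log p / (b : EReal) ≤ (c : EReal) := by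
  rw [EReal.div_le_iff_le_mul (EReal.coe_pos.2 hb) (EReal.coe_ne_top b), ← EReal.coe_mul,
    ← Real.log_exp (b * c), ← ENNReal.log_ofReal_of_pos (Real.exp_pos _)]
  exact ENNReal.log_monotone ((ENNReal.le_ofReal_iff_toReal_le hp (Real.exp_nonneg _)).2 h)

theorem le_ennrealLog_div_of_le_toReal {p : ℝ≥0∞} {b c : ℝ} (hb : 0 < b)
    (h : Real.exp (b * c) ≤ p.toReal) : (c : EReal) ≤ ENNReal.log p / (b : EReal) := by
  rw [EReal.le_div_iff_mul_le (EReal.coe_pos.2 hb) (EReal.coe_ne_top b), ← EReal.coe_mul,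
    mul_comm, ← Real.log_exp (b * c), ← ENNReal.log_ofReal_of_pos (Real.exp_pos _)]
  exact ENNReal.log_monotone (ENNReal.ofReal_le_of_le_toReal h)

theorem measureReal_le_of_forall_le_abs {μ : Measure ℝ} [IsFiniteMeasure μ]
    (hint : ∀ θ : ℝ, Integrable (fun x => Real.exp (θ * x)) μ) {A : Set ℝ} {r b : ℝ} (hr : 0 ≤ r)
    (hb : 0 ≤ b) (hA : ∀ x ∈ A, r ≤ |x|) :
    μ.real A ≤ Real.exp (-(b * r ^ 2) + cgf id μ (r * b))
      + Real.exp (-(b * r ^ 2) + cgf id μ (-r * b)) := by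
  have hge := measure_ge_le_exp_cgf (μ := μ) (X := id) r (mul_nonneg hr hb) (hint _)
  have hle := measure_le_le_exp_cgf (μ := μ) (X := id) (-r)
    (mul_nonpos_of_nonpos_of_nonneg (neg_nonpos.2 hr) hb) (hint _)
  have hsub : A ⊆ {x | r ≤ id x} ∪ {x | id x ≤ -r} := fun x hx => (le_abs'.1 (hA x hx)).symm
  refine (measureReal_mono hsub).trans ((measureReal_union_le _ _).trans ?_)
  convert! add_le_add hge hle using 3 <;> ring

theorem exp_mul_le_indicator_ball_add (x : ℝ) {δ b : ℝ} (hδ : 0 < δ) (hb : 0 ≤ b) (z : ℝ) :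
    Real.exp (x * b * z)
      ≤ (Metric.ball x δ).indicator (fun _ => Real.exp (b * (x ^ 2 + |x| * δ))) z
        + Real.exp (-b * δ * (x + δ)) * Real.exp ((x + δ) * b * z)
        + Real.exp (b * δ * (x - δ)) * Real.exp ((x - δ) * b * z) := by
  rw [← Real.exp_add, ← Real.exp_add]
  have hright := Real.exp_pos (-b * δ * (x + δ) + (x + δ) * b * z)
  have hleft := Real.exp_pos (b * δ * (x - δ) + (x - δ) * b * z)
  by_cases hz : z ∈ Metric.ball x δ
  · rw [Set.indicator_of_mem hz]
    have hxz : x * (z - x) ≤ |x| * δ :=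
      (le_abs_self _).trans ((abs_mul _ _).trans_le (by gcongr; exact (Metric.mem_ball.1 hz).le))
    have : Real.exp (x * b * z) ≤ Real.exp (b * (x ^ 2 + |x| * δ)) :=
      Real.exp_le_exp.2 (by linarith [mul_le_mul_of_nonneg_left hxz hb])
    linarith
  · rw [Set.indicator_of_notMem hz]
    rw [Metric.mem_ball, Real.dist_eq, not_lt] at hz
    rcases le_abs'.1 hz with h | h
    · have : Real.exp (x * b * z) ≤ Real.exp (b * δ * (x - δ) + (x - δ) * b * z) :=
        Real.exp_le_exp.2 (by
          linarith [mul_nonneg (mul_nonneg hb hδ.le) (show 0 ≤ x - δ - z by linarith)])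
      linarith
    · have : Real.exp (x * b * z) ≤ Real.exp (-b * δ * (x + δ) + (x + δ) * b * z) :=
        Real.exp_le_exp.2 (by
          linarith [mul_nonneg (mul_nonneg hb hδ.le) (show 0 ≤ z - x - δ by linarith)])
      linarith

theorem mgf_le_measureReal_ball_add {μ : Measure ℝ} [IsFiniteMeasure μ]
    (hint : ∀ θ : ℝ, Integrable (fun x => Real.exp (θ * x)) μ) (x : ℝ) {δ b : ℝ} (hδ : 0 < δ)
    (hb : 0 ≤ b) :
    mgf id μ (x * b) ≤ Real.exp (b * (x ^ 2 + |x| * δ)) * μ.real (Metric.ball x δ)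
      + Real.exp (-b * δ * (x + δ)) * mgf id μ ((x + δ) * b)
      + Real.exp (b * δ * (x - δ)) * mgf id μ ((x - δ) * b) := by
  have hball : Integrable ((Metric.ball x δ).indicator fun _ => Real.exp (b * (x ^ 2 + |x| * δ)))
      μ := (integrable_const _).indicator measurableSet_ball
  have hright := (hint ((x + δ) * b)).const_mul (Real.exp (-b * δ * (x + δ)))
  have hleft := (hint ((x - δ) * b)).const_mul (Real.exp (b * δ * (x - δ)))
  refine (integral_mono (hint _) ((hball.add hright).add hleft)
    (exp_mul_le_indicator_ball_add x hδ hb)).trans_eq ?_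
  rw [integral_add' (hball.add hright) hleft, integral_add' hball hright, integral_const_mul,
    integral_const_mul, integral_indicator_const _ measurableSet_ball, smul_eq_mul,
    mul_comm (μ.real _)]
  rfl

section

variable {ι : Type*} {l : Filter ι} {P : ι → Measure ℝ} {b : ι → ℝ}
  (hP : ∀ᶠ i in l, IsProbabilityMeasure (P i))
  (hint : ∀ i, ∀ θ : ℝ, Integrable (fun x => Real.exp (θ * x)) (P i)) (hb : Tendsto b l atTop)
  (h : ∀ θ : ℝ, Tendsto (fun i => cgf id (P i) (θ * b i) / b i) l (𝓝 (θ ^ 2 / 2)))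

include hP hint hb h

theorem eventually_measureReal_le_exp {A : Set ℝ} {r c : ℝ} (hr : 0 ≤ r) (hA : ∀ x ∈ A, r ≤ |x|)
    (hc : -(r ^ 2 / 2) < c) :
    ∀ᶠ i in l, (P i).real A ≤ Real.exp (b i * c) := by
  obtain ⟨c', hc', hcc'⟩ := exists_between hc
  filter_upwards [hP, (h r).eventually_lt_const (u := r ^ 2 + c') (by linarith),
    (h (-r)).eventually_lt_const (u := r ^ 2 + c') (by linarith [neg_sq r]),
    hb.eventually_gt_atTop 0,
    (hb.atTop_mul_const (sub_pos.2 hcc')).eventually_ge_atTop (Real.log 2)]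
    with i _ hpos hneg hbi hlog
  rw [div_lt_iff₀ hbi] at hpos hneg
  have hhalf (s : ℝ) (hs : s < (r ^ 2 + c') * b i) :
      Real.exp (-(b i * r ^ 2) + s) ≤ Real.exp (b i * c) / 2 := by
    rw [← Real.exp_log (two_pos : (0 : ℝ) < 2), ← Real.exp_sub]
    exact Real.exp_le_exp.2 (by linarith)
  linarith [measureReal_le_of_forall_le_abs (hint i) hr hbi.le hA, hhalf _ hpos, hhalf _ hneg]

theorem eventually_exp_le_measureReal_ball {x c δ : ℝ} (hδ : 0 < δ)
    (hc : c + |x| * δ + δ ^ 2 / 8 < -(x ^ 2 / 2)) :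
    ∀ᶠ i in l, Real.exp (b i * c) ≤ (P i).real (Metric.ball x δ) := by
  have hδ2 : 0 < δ ^ 2 / 8 := by positivity
  filter_upwards [hP,
    (h x).eventually_const_lt (u := x ^ 2 / 2 - δ ^ 2 / 8) (by linarith),
    (h (x + δ)).eventually_lt_const (u := (x + δ) ^ 2 / 2 + δ ^ 2 / 8) (by linarith),
    (h (x - δ)).eventually_lt_const (u := (x - δ) ^ 2 / 2 + δ ^ 2 / 8) (by linarith),
    hb.eventually_gt_atTop 0,
    (hb.atTop_mul_const (by positivity : 0 < δ ^ 2 / 4)).eventually_ge_atTop (Real.log 4),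
    (hb.atTop_mul_const (sub_pos.2 hc)).eventually_ge_atTop (Real.log 2)]
    with i _ hx hright hleft hbi hlog4 hlog2
  have hmgf := mgf_le_measureReal_ball_add (hint i) x hδ hbi.le
  rw [← exp_cgf (X := id) (hint i _), ← exp_cgf (X := id) (hint i _),
    ← exp_cgf (X := id) (hint i _), ← Real.exp_add, ← Real.exp_add] at hmgf
  rw [lt_div_iff₀ hbi] at hx
  rw [div_lt_iff₀ hbi] at hright hleft
  set E := Real.exp (b i * (x ^ 2 / 2 - δ ^ 2 / 8)) with hE
  have hmid : E ≤ Real.exp (cgf id (P i) (x * b i)) := Real.exp_le_exp.2 (by linarith)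
  have hquarter (s : ℝ) (hs : s ≤ b i * (x ^ 2 / 2 - δ ^ 2 / 8) - Real.log 4) :
      Real.exp s ≤ E / 4 := by
    rw [hE, ← Real.exp_log (four_pos : (0 : ℝ) < 4), ← Real.exp_sub]
    exact Real.exp_le_exp.2 hs
  have hhalf : Real.exp (b i * (x ^ 2 + |x| * δ)) * Real.exp (b i * c) ≤ E / 2 := by
    rw [hE, ← Real.exp_log (two_pos : (0 : ℝ) < 2), ← Real.exp_sub, ← Real.exp_add]
    exact Real.exp_le_exp.2 (by rw [Real.exp_log two_pos]; linarith)
  refine le_of_mul_le_mul_left ?_ (Real.exp_pos (b i * (x ^ 2 + |x| * δ)))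
  linarith [hquarter (-b i * δ * (x + δ) + cgf id (P i) ((x + δ) * b i)) (by linarith),
    hquarter (b i * δ * (x - δ) + cgf id (P i) ((x - δ) * b i)) (by linarith)]

theorem eventually_exp_le_measureReal_of_mem_interior
    {A : Set ℝ} {x c : ℝ} (hx : x ∈ interior A) (hc : c < -(x ^ 2 / 2)) :
    ∀ᶠ i in l, Real.exp (b i * c) ≤ (P i).real A := by
  obtain ⟨ε, hε, hball⟩ := Metric.isOpen_iff.1 isOpen_interior x hx
  have hlim : Tendsto (fun δ : ℝ => c + |x| * δ + δ ^ 2 / 8) (𝓝[>] 0) (𝓝 c) :=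
    (Continuous.tendsto' (by fun_prop) 0 c (by simp)).mono_left nhdsWithin_le_nhds
  obtain ⟨δ, hδc, hδ, hδε⟩ := ((hlim.eventually_lt_const hc).and (Ioo_mem_nhdsGT hε)).exists
  filter_upwards [hP, eventually_exp_le_measureReal_ball hP hint hb h hδ hδc] with i _ hi
  exact hi.trans (measureReal_mono
    ((Metric.ball_subset_ball hδε.le).trans (hball.trans interior_subset)))

theorem neg_iInf_interior_le_liminf (A : Set ℝ) :
    -(⨅ x ∈ interior A, ((x ^ 2 / 2 : ℝ) : EReal))
      ≤ liminf (fun i => ENNReal.log (P i A) / (b i : EReal)) l := by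
  refine le_of_forall_lt_imp_le_of_dense fun y hy => ?_
  rw [EReal.lt_neg_comm] at hy
  simp only [iInf_lt_iff] at hy
  obtain ⟨x, hx, hxy⟩ := hy
  rw [EReal.lt_neg_comm, ← EReal.coe_neg] at hxy
  obtain ⟨c, hyc, hcx⟩ := EReal.lt_iff_exists_real_btwn.1 hxy
  refine hyc.le.trans (le_liminf_of_le (by isBoundedDefault) ?_)
  filter_upwards [hb.eventually_gt_atTop 0, eventually_exp_le_measureReal_of_mem_interior hP hint
    hb h hx (EReal.coe_lt_coe_iff.1 hcx)] with i hbi hi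
  exact le_ennrealLog_div_of_le_toReal hbi hi

theorem limsup_le_neg_iInf_closure (A : Set ℝ) :
    limsup (fun i => ENNReal.log (P i A) / (b i : EReal)) l
      ≤ -(⨅ x ∈ closure A, ((x ^ 2 / 2 : ℝ) : EReal)) := by
  refine le_of_forall_gt_imp_ge_of_dense fun y hy => ?_
  obtain ⟨c, hc, hcy⟩ := EReal.lt_iff_exists_real_btwn.1 hy
  obtain ⟨c', hcc', hc'y⟩ := EReal.lt_iff_exists_real_btwn.1 hcy
  refine (limsup_le_of_le (by isBoundedDefault) ?_).trans hc'y.le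
  have hA (x : ℝ) (hx : x ∈ A) : √(-(2 * c)) ≤ |x| := by
    have := (EReal.neg_lt_comm.1 hc).trans_le (iInf₂_le x (subset_closure hx))
    rw [← EReal.coe_neg, EReal.coe_lt_coe_iff] at this
    exact Real.sqrt_le_iff.2 ⟨abs_nonneg x, by rw [sq_abs]; linarith⟩
  have hr : -(√(-(2 * c)) ^ 2 / 2) < c' := by
    have : -(2 * c) ≤ √(-(2 * c)) ^ 2 := Real.sq_sqrt' ▸ le_max_left _ _
    linarith [EReal.coe_lt_coe_iff.1 hcc']
  filter_upwards [hP, hb.eventually_gt_atTop 0, eventually_measureReal_le_exp hP hint hb h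
    (Real.sqrt_nonneg _) hA hr] with i _ hbi hi
  exact ennrealLog_div_le_of_toReal_le (measure_ne_top _ _) hbi hi

end

theorem satisfiesLDP_of_tendsto_cgf {P : ℕ → Measure ℝ} {b : ℕ → ℝ}
    (hP : ∀ᶠ n in atTop, IsProbabilityMeasure (P n))
    (hint : ∀ n, ∀ θ : ℝ, Integrable (fun x => Real.exp (θ * x)) (P n))
    (hb : Tendsto b atTop atTop)
    (h : ∀ θ : ℝ, Tendsto (fun n => cgf id (P n) (θ * b n) / b n) atTop (𝓝 (θ ^ 2 / 2))) :
    SatisfiesLDP P b (fun x => ((x ^ 2 / 2 : ℝ) : EReal)) where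
  nonneg x := EReal.coe_nonneg.2 (by positivity)
  lowerSemicontinuous :=
    (continuous_coe_real_ereal.comp (by fun_prop)).lowerSemicontinuous
  lower A _ := neg_iInf_interior_le_liminf hP hint hb h A
  upper A _ := limsup_le_neg_iInf_closure hP hint hb h A

/-! ### Consequences of the limit law -/

theorem integral_primeLaw (g : ℕ → ℝ) (n : ℕ) (f : ℝ → ℝ) :
    ∫ y, f y ∂(primeLaw g n) = meanSum (f ∘ g) n / meanSum 1 n := by
  have htop (p : ℕ) (hp : p ∈ Nat.primesLE n) : (p : ℝ≥0∞)⁻¹ ≠ ∞ :=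
    ENNReal.inv_ne_top.2 (Nat.cast_ne_zero.2 (Nat.prime_of_mem_primesLE hp).ne_zero)
  rw [primeLaw, integral_smul_measure, integral_finsetSum_measure fun p hp =>
    (integrable_dirac (by simp)).smul_measure (htop p hp), ENNReal.toReal_inv,
    ENNReal.toReal_sum htop, smul_eq_mul, inv_mul_eq_div]
  simp [meanSum, integral_smul_measure, div_eq_inv_mul]

theorem one_lt_integral_cosh {ρ : Measure ℝ} [IsProbabilityMeasure ρ]
    (hint : Integrable Real.cosh ρ) (hρ : ρ ≠ Measure.dirac 0) : 1 < ∫ y, Real.cosh y ∂ρ := by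
  have hsupp : Function.support (fun y => Real.cosh y - 1) = {0}ᶜ := by
    ext y
    rw [Function.mem_support, sub_ne_zero, Set.mem_compl_singleton_iff, ← Real.one_lt_cosh,
      (Real.one_le_cosh y).lt_iff_ne']
  have hne : ρ {0}ᶜ ≠ 0 := fun h0 => hρ <| by
    have hae : ∀ᵐ y ∂ρ, y ∈ ({0} : Set ℝ) := mem_ae_iff.2 h0
    rw [← Measure.restrict_eq_self_of_ae_mem hae, Measure.restrict_singleton,
      (prob_compl_eq_zero_iff (measurableSet_singleton 0)).1 h0, one_smul]
  have hpos : 0 < ∫ y, (Real.cosh y - 1) ∂ρ := by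
    rw [integral_pos_iff_support_of_nonneg (fun y => sub_nonneg.2 (Real.one_le_cosh y))
      (hint.sub (integrable_const 1)), hsupp]
    exact pos_iff_ne_zero.2 hne
  rwa [integral_sub hint (integrable_const 1), integral_const, probReal_univ, one_smul,
    sub_pos] at hpos

theorem meanSum_cosh_sub_one_sq_le (g : ℕ → ℝ) (n : ℕ) :
    meanSum (fun p => Real.cosh (g p) - 1) n ^ 2 ≤ varSum g n * meanSum (expAbs 2 g) n := by
  have hle : (fun p => Real.cosh (g p) - 1) ≤ |g| * expAbs 1 g := fun p => by
    have hpos := (le_abs_self _).trans (abs_exp_sub_one_le_mul_exp (g p))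
    have hneg := (le_abs_self _).trans (abs_exp_sub_one_le_mul_exp (-g p))
    rw [abs_neg] at hneg
    simp only [Real.cosh_eq, Pi.mul_apply, Pi.abs_apply, expAbs, one_mul]
    linarith
  calc meanSum (fun p => Real.cosh (g p) - 1) n ^ 2
      ≤ meanSum (|g| * expAbs 1 g) n ^ 2 := by
        gcongr
        · exact meanSum_nonneg (fun p => sub_nonneg.2 (Real.one_le_cosh (g p))) n
        · exact meanSum_le_meanSum hle n
    _ ≤ meanSum (|g| ^ 2) n * meanSum (expAbs 1 g ^ 2) n := meanSum_mul_sq_le _ _ n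
    _ = varSum g n * meanSum (expAbs 2 g) n := by
        rw [expAbs_pow, Nat.cast_ofNat, mul_one]
        simp only [meanSum, varSum, Pi.pow_apply, Pi.abs_apply, sq_abs]

section

variable {g : ℕ → ℝ} {ρ : Measure ℝ}

theorem HasLimitLaw.tendsto_meanSum_exp (hg : HasLimitLaw g ρ) (θ : ℝ) :
    Tendsto (fun n => meanSum (fun p => Real.exp (θ * g p)) n / meanSum 1 n) atTop
      (𝓝 (∫ y, Real.exp (θ * y) ∂ρ)) := by
  simpa only [integral_primeLaw] using! hg.tendsto_mgf θ

theorem HasLimitLaw.meanSum_exp_isBigO (hg : HasLimitLaw g ρ) (θ : ℝ) :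
    meanSum (fun p => Real.exp (θ * g p)) =O[atTop] meanSum 1 :=
  isBigO_of_div_tendsto_nhds ((tendsto_meanSum_one_atTop.eventually_ne_atTop 0).mono
    fun _ hn h => absurd h hn) _ (hg.tendsto_meanSum_exp θ)

theorem HasLimitLaw.meanSum_expAbs_isBigO (hg : HasLimitLaw g ρ) (κ : ℝ) :
    meanSum (expAbs κ g) =O[atTop] meanSum 1 := by
  refine IsBigO.trans (.of_norm_le fun n => ?_)
    ((hg.meanSum_exp_isBigO κ).add (hg.meanSum_exp_isBigO (-κ)))
  rw [Real.norm_of_nonneg (meanSum_nonneg (expAbs_nonneg κ g) n), ← meanSum_add]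
  refine meanSum_le_meanSum (fun p => ?_) n
  rw [expAbs, Pi.add_apply, neg_mul]
  refine (Real.exp_le_exp.2 ?_).trans (Real.exp_abs_le (κ * g p))
  rw [abs_mul]
  gcongr
  exact le_abs_self κ

theorem HasLimitLaw.integrable_cosh (hg : HasLimitLaw g ρ) : Integrable Real.cosh ρ := by
  have := ((hg.integrable_exp 1).add (hg.integrable_exp (-1))).div_const 2
  simpa only [Pi.add_def, one_mul, neg_one_mul, ← Real.cosh_eq] using this

theorem HasLimitLaw.tendsto_meanSum_cosh_sub_one (hg : HasLimitLaw g ρ) :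
    Tendsto (fun n => meanSum (fun p => Real.cosh (g p) - 1) n / meanSum 1 n) atTop
      (𝓝 (∫ y, Real.cosh y ∂ρ - 1)) := by
  have heq (n : ℕ) : meanSum (fun p => Real.cosh (g p) - 1) n
      = (meanSum (fun p => Real.exp (1 * g p)) n + meanSum (fun p => Real.exp (-1 * g p)) n) / 2
        - meanSum 1 n := by
    simp only [meanSum, ← Finset.sum_add_distrib, Finset.sum_div, ← Finset.sum_sub_distrib]
    refine Finset.sum_congr rfl fun p _ => ?_
    rw [Real.cosh_eq, one_mul, neg_one_mul, Pi.one_apply]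
    ring
  have hint : ∫ y, Real.cosh y ∂ρ
      = (∫ y, Real.exp (1 * y) ∂ρ + ∫ y, Real.exp (-1 * y) ∂ρ) / 2 := by
    rw [← integral_add (hg.integrable_exp 1) (hg.integrable_exp (-1)), ← integral_div]
    simp only [one_mul, neg_one_mul, ← Real.cosh_eq]
  rw [hint]
  refine ((((hg.tendsto_meanSum_exp 1).add (hg.tendsto_meanSum_exp (-1))).div_const 2).sub_const
    1).congr' ?_
  filter_upwards [tendsto_meanSum_one_atTop.eventually_ne_atTop 0] with n hn
  rw [heq]
  field_simp

theorem HasLimitLaw.meanSum_one_isBigO_varSum [IsProbabilityMeasure ρ] (hg : HasLimitLaw g ρ)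
    (hρ : ρ ≠ Measure.dirac 0) : meanSum 1 =O[atTop] varSum g := by
  set T : ℕ → ℝ := meanSum fun p => Real.cosh (g p) - 1
  have hpos : 0 < ∫ y, Real.cosh y ∂ρ - 1 := sub_pos.2 (one_lt_integral_cosh hg.integrable_cosh hρ)
  have hT := hg.tendsto_meanSum_cosh_sub_one
  have hLT : meanSum 1 =O[atTop] T := by
    refine isBigO_of_div_tendsto_nhds ?_ _ ((hT.inv₀ hpos.ne').congr fun n => inv_div _ _)
    filter_upwards [hT.eventually_ne hpos.ne'] with n hn h0
    exact absurd (by simp [T] at h0; simp [h0]) hn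
  have hTV : (fun n => T n ^ 2) =O[atTop] fun n => varSum g n * meanSum 1 n :=
    IsBigO.trans (.of_norm_le fun n => by
      rw [Real.norm_of_nonneg (sq_nonneg _)]
      exact meanSum_cosh_sub_one_sq_le g n)
      ((isBigO_refl _ _).mul (hg.meanSum_expAbs_isBigO 2))
  refine (((hLT.pow 2).trans hTV).mul (isBigO_refl (fun n => (meanSum 1 n)⁻¹) atTop)).congr' ?_ ?_
  all_goals
    filter_upwards [tendsto_meanSum_one_atTop.eventually_ne_atTop 0] with n hn
    field_simp

end

/-! ### The laws of the normalized additive function -/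

theorem StronglyAdditive.eq_sum_primeFactors {g : ℕ → ℝ} (hg : StronglyAdditive g) {m : ℕ}
    (hm : m ≠ 0) : g m = ∑ p ∈ m.primeFactors, g p := by
  induction m using Nat.recOnPosPrimePosCoprime with
  | zero => exact absurd rfl hm
  | one => simpa using hg.mul 1 1 (Nat.coprime_one_left 1)
  | prime_pow p k hp hk =>
    rw [hg.prime_pow p k hp hk, Nat.primeFactors_prime_pow hk.ne' hp, Finset.sum_singleton]
  | coprime a b ha hb hab iha ihb =>
    rw [hg.mul a b hab, hab.primeFactors_mul, Finset.sum_union hab.disjoint_primeFactors,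
      ← iha (by omega), ← ihb (by omega)]

section

variable {Ω E : Type*} [MeasurableSpace Ω] [MeasurableSingletonClass Ω] [NormedAddCommGroup E]

theorem restrict_uniformOn_finset (s : Finset Ω) :
    (uniformOn (s : Set Ω)).restrict s = uniformOn (s : Set Ω) := by
  rw [uniformOn, ProbabilityTheory.cond, Measure.restrict_smul,
    Measure.restrict_restrict s.measurableSet, Set.inter_self]

theorem integrable_uniformOn_finset (s : Finset Ω) (f : Ω → E) :
    Integrable f (uniformOn (s : Set Ω)) := by
  rw [← restrict_uniformOn_finset]
  exact IntegrableOn.finset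

theorem integral_uniformOn_finset [NormedSpace ℝ E] [CompleteSpace E] (s : Finset Ω) (f : Ω → E) :
    ∫ ω, f ω ∂(uniformOn (s : Set Ω)) = (s.card : ℝ)⁻¹ • ∑ ω ∈ s, f ω := by
  classical
  rw [← restrict_uniformOn_finset,
    setIntegral_finset s (integrable_uniformOn_finset s f).integrableOn, Finset.smul_sum]
  refine Finset.sum_congr rfl fun ω hω => ?_
  rw [measureReal_def, ← Finset.coe_singleton, uniformOn_apply_finset,
    Finset.inter_singleton_of_mem hω]
  simp

end

theorem integrable_scaledLaw (g a : ℕ → ℝ) (n : ℕ) {f : ℝ → ℝ} (hf : Measurable f) :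
    Integrable f (scaledLaw g a n) := by
  rw [scaledLaw, integrable_map_measure hf.aestronglyMeasurable
    Measurable.of_discrete.aemeasurable, ← Finset.coe_Icc]
  exact integrable_uniformOn_finset _ _

theorem mgf_scaledLaw {g : ℕ → ℝ} (hg : StronglyAdditive g) (a : ℕ → ℝ) (n : ℕ) (s : ℝ) :
    mgf id (scaledLaw g a n) s = meanProd (fun p => Real.exp (((s / a n) • g) p) - 1) n
      * Real.exp (-meanSum ((s / a n) • g) n) := by
  rw [scaledLaw, mgf_id_map Measurable.of_discrete.aemeasurable, mgf, ← Finset.coe_Icc,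
    integral_uniformOn_finset, Nat.card_Icc, Nat.add_sub_cancel, meanProd_exp_sub_one,
    smul_eq_mul, div_mul_eq_mul_div, inv_mul_eq_div, Finset.sum_mul]
  congr 1
  refine Finset.sum_congr rfl fun m hm => ?_
  simp only [← Real.exp_add, meanSum_smul, Pi.smul_apply, smul_eq_mul, ← Finset.mul_sum,
    ← hg.eq_sum_primeFactors (Finset.mem_Ioc.1 hm).1.ne']
  ring_nf

theorem cgf_scaledLaw {g : ℕ → ℝ} (hg : StronglyAdditive g) (a : ℕ → ℝ) {n : ℕ} (hn : n ≠ 0)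
    (s : ℝ) : cgf id (scaledLaw g a n) s = centeredCgf ((s / a n) • g) n := by
  rw [cgf, mgf_scaledLaw hg, Real.log_mul (meanProd_exp_sub_one_pos _ hn).ne' (Real.exp_ne_zero _),
    Real.log_exp, centeredCgf, sub_eq_add_neg]

theorem tendsto_varSum_atTop {g : ℕ → ℝ} (hvar : meanSum 1 =O[atTop] varSum g) :
    Tendsto (varSum g) atTop atTop := by
  have hnorm := hvar.trans_tendsto_norm_atTop
    (tendsto_norm_atTop_atTop.comp tendsto_meanSum_one_atTop)
  exact hnorm.congr fun n => Real.norm_of_nonneg (varSum_nonneg g n)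

theorem tendsto_sq_div_atTop {ι : Type*} {l : Filter ι} {a v : ι → ℝ} (ha : ∀ᶠ i in l, 0 < a i)
    (hv : ∀ᶠ i in l, 0 < v i) (h : (fun i => √(v i)) =o[l] a) :
    Tendsto (fun i => a i ^ 2 / v i) l atTop := by
  have hinv : Tendsto (fun i => √(v i) / a i) l (𝓝[>] 0) := by
    refine tendsto_nhdsWithin_iff.2 ⟨h.tendsto_div_nhds_zero, ?_⟩
    filter_upwards [ha, hv] with i hai hvi
    exact div_pos (Real.sqrt_pos.2 hvi) hai
  refine ((tendsto_pow_atTop two_ne_zero).comp hinv.inv_tendsto_nhdsGT_zero).congr' ?_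
  filter_upwards [hv] with i hvi
  rw [Function.comp_apply, Pi.inv_apply, inv_div, div_pow, Real.sq_sqrt hvi.le]

theorem tendsto_cgf_scaledLaw {g : ℕ → ℝ} (hg : StronglyAdditive g) {κ : ℝ} (hκ : 0 < κ)
    (hexp : meanSum (expAbs κ g) =O[atTop] meanSum 1) (hvar : meanSum 1 =O[atTop] varSum g)
    {a : ℕ → ℝ} (ha : ∀ᶠ n in atTop, 0 < a n) (haσ : a =o[atTop] varSum g)
    (hb : Tendsto (fun n => a n ^ 2 / varSum g n) atTop atTop) (θ : ℝ) :
    Tendsto (fun n => cgf id (scaledLaw g a n) (θ * (a n ^ 2 / varSum g n)) /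
      (a n ^ 2 / varSum g n)) atTop (𝓝 (θ ^ 2 / 2)) := by
  set s : ℕ → ℝ := fun n => θ * (a n / varSum g n) with hs_def
  have hs : Tendsto s atTop (𝓝 0) := by
    simpa only [mul_zero] using haσ.tendsto_div_nhds_zero.const_mul θ
  have hvarSum : Tendsto (fun n => varSum (s n • g) n / (a n ^ 2 / varSum g n)) atTop
      (𝓝 (θ ^ 2)) := by
    refine tendsto_const_nhds.congr' ?_
    filter_upwards [ha, (tendsto_varSum_atTop hvar).eventually_gt_atTop 0] with n han hn
    rw [varSum_smul, hs_def]
    field_simp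
  refine (tendsto_centeredCgf hκ hexp hvar hs hb hvarSum).congr' ?_
  filter_upwards [ha, eventually_ne_atTop 0] with n han hn
  have hsn : θ * (a n ^ 2 / varSum g n) / a n = s n := by
    rw [hs_def]
    field_simp
  rw [cgf_scaledLaw hg a hn, hsn]

end ErdosKac

theorem theorem2_general (g : ℕ → ℝ) (hg : ErdosKac.StronglyAdditive g) {κ : ℝ} (hκ : 0 < κ)
    (hexp : ErdosKac.meanSum (ErdosKac.expAbs κ g) =O[atTop] ErdosKac.meanSum 1)
    (hvar : ErdosKac.meanSum 1 =O[atTop] ErdosKac.varSum g)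
    (a : ℕ → ℝ) (ha : ∀ n, 0 < a n)
    (hσa : (fun n => Real.sqrt (ErdosKac.varSum g n)) =o[atTop] a)
    (haσ : a =o[atTop] (fun n => ErdosKac.varSum g n)) :
    ErdosKac.SatisfiesLDP (ErdosKac.scaledLaw g a)
      (fun n => a n ^ 2 / ErdosKac.varSum g n)
      (fun x => ((x ^ 2 / 2 : ℝ) : EReal)) := by
  have hb : Tendsto (fun n => a n ^ 2 / ErdosKac.varSum g n) atTop atTop :=
    ErdosKac.tendsto_sq_div_atTop (.of_forall ha)
      ((ErdosKac.tendsto_varSum_atTop hvar).eventually_gt_atTop 0) hσa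
  have hprob : ∀ᶠ n in atTop, IsProbabilityMeasure (ErdosKac.scaledLaw g a n) :=
    (eventually_ge_atTop 1).mono fun n hn => ErdosKac.isProbabilityMeasure_scaledLaw g a hn
  exact ErdosKac.satisfiesLDP_of_tendsto_cgf hprob
    (fun n θ => ErdosKac.integrable_scaledLaw g a n (by fun_prop)) hb
    (ErdosKac.tendsto_cgf_scaledLaw hg hκ hexp hvar (.of_forall ha) haσ hb)

theorem theorem2 (g : ℕ → ℝ) (ρ : Measure ℝ) [IsProbabilityMeasure ρ]
    (hg : ErdosKac.HasLimitLaw g ρ) (hρ : ρ ≠ Measure.dirac 0)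
    (a : ℕ → ℝ) (ha : ∀ n, 0 < a n)
    (hσa : (fun n => Real.sqrt (ErdosKac.varSum g n)) =o[atTop] a)
    (haσ : a =o[atTop] (fun n => ErdosKac.varSum g n)) :
    ErdosKac.SatisfiesLDP (ErdosKac.scaledLaw g a)
      (fun n => a n ^ 2 / ErdosKac.varSum g n)
      (fun x => ((x ^ 2 / 2 : ℝ) : EReal)) := by
  exact theorem2_general g hg.stronglyAdditive one_pos (hg.meanSum_expAbs_isBigO 1)
    (hg.meanSum_one_isBigO_varSum hρ) a ha hσa haσ
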